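/- Fix $R\ge 1$, $\lambda>0$ and $p=(p_1,\dots,p_R)$ with positive integer entries; put $\|p\|=\sum_r p_r$. For $k\ge 1$ consider $kR$ first-come-first-served queues $(r,\kappa)$, $1\le r\le R$, $1\le\kappa\le k$. Jobs $1,2,\dots$ arrive at a dispatcher with i.i.d. inter-arrival times $T^{(k)}_n$ that are either exponential with rate $\lambda k$ for all $k$ (Poisson arrivals) or constant, equal to $1/(\lambda k)$, for all $k$. Service times are positive and independent of each other and of the arrivals; those at the queues of type $r$ have a common law, independent of $\kappa$ and $k$, with mean $1/\mu_r$. A policy is a map $\pi:\{1,2,\dots\}\to\{1,\dots,R\}\times\{1,\dots,k\}$; job $n$ is sent to queue $\pi(n)$. Let $\overline{\mathcal A}_p(k)$ be the set of periodic policies such that the fraction $q_{r,\kappa}$ of jobs sent to each queue $(r,\kappa)$ is positive and $\sum_{\kappa}q_{r,\kappa}=p_r/\|p\|$ for all $r$, and let $\overline{\mathcal A}^{*}_p(k)\subseteq\overline{\mathcal A}_p(k)$ consist of those that have as a period the least positive integer $n^*(q)$ for which $n^*(q)\,q$ is an integer vector. Let $\mathcal C_p^{(k)}$ be the set of $\pi\in\overline{\mathcal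 A}_p(k)$ for which the sequence of types of the queues chosen has period $\|p\|$, with exactly $p_r$ jobs sent to type $r$ per period, and for which, for each $r$, the queues of type $r$ are visited in the cyclic order $(r,1),(r,2),\dots,(r,k),(r,1),\dots$, starting from $(r,1)$. For $\pi\in\overline{\mathcal A}_p(k)$ let $(T_{n,r,\kappa})_{n\in\mathbb Z}$ be the two-sided stationary version of the sequence of inter-arrival times that $\pi$ induces at queue $(r,\kappa)$: its repeated pattern of inter-arrival times (each a sum of consecutive $T^{(k)}_n$) is started from a uniformly chosen element of the pattern. With $(S_{n,r,\kappa})_{n\in\mathbb Z}$ the service times at that queue, the stationary waiting time there is $$W^{(k)}_{r,\kappa}(\pi)=\Big(\sup_{n\ge 0}\sum_{n'=0}^{n}\big(S_{-n',r,\kappa}-T_{-n',r,\kappa}\big)\Big)^{+}\in[0,\infty],$$ and $W^{(k)}(\pi)$ is the mixture of the $W^{(k)}_{r,\kappa}(\pi)$ with weights $q_{r,\kappa}$. Let $W_r(p)$ be defined by the same formula, with the service times of type $r$ and constant inter-arrival times $\|p\|/(p_r\lambda)$ (the stationary waiting time of a D/GI/1 queue), and let $W(p)$ be the mixture of $W_1(p),\dots,W_R(p)$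 with weights $p_r/\|p\|$, so that $\mathbb E W(p)=\sum_r\frac{p_r}{\|p\|}\mathbb E W_r(p)$. Theorem. Suppose that $\lambda\frac{p_r}{\|p\|}<\mu_r$ for all $r$ and that the service times have finite third moments. Let $\pi^{(k)}\in\mathcal C_p^{(k)}$ for all $k\ge1$. Then $\mathbb E W(p)<\infty$, $$\lim_{k\to\infty}\mathbb E W^{(k)}(\pi^{(k)})=\mathbb E W(p),$$ $$\liminf_{k\to\infty}\ \inf_{\pi\in\overline{\mathcal A}_p(k)}\mathbb E W^{(k)}(\pi)=\lim_{k\to\infty}\mathbb E W^{(k)}(\pi^{(k)}),$$ and the last equality also holds with $\overline{\mathcal A}^{*}_p(k)$ in place of $\overline{\mathcal A}_p(k)$. If moreover the service times have finite fifth moments, then $\mathbb E[W_r(p)^2]<\infty$ for all $r$, $\mathbb E[W^{(k)}(\pi^{(k)})^2]<\infty$ for all large $k$, and $$\lim_{k\to\infty}\operatorname{Var}W^{(k)}(\pi^{(k)})=\sum_r\frac{p_r}{\|p\|}\Big(\operatorname{Var}W_r(p)+\big(\mathbb E W_r(p)-\mathbb E W(p)\big)^2\Big).$$ -/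

import Mathlib

open MeasureTheory ProbabilityTheory Filter Topology
open scoped ENNReal

namespace ParallelQueues

noncomputable section

/-- Queues: the pair `(r, κ)` is the `κ`-th queue of type `r` (both coordinates start from `0`). -/
abbrev Queue (R k : ℕ) := Fin R × Fin k

/-- A routing of the jobs `0, 1, 2, …` to the queues. -/
abbrev Policy (R k : ℕ) := ℕ → Queue R k

/-- The `L₁`-norm of `p`. -/
def l1 {R : ℕ} (p : Fin R → ℕ) : ℕ := ∑ r, p r

/-! ### Periodic policies -/

/-- Policies having `N` as a period and sending `N * q i` jobs per period to each queue `i`. -/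
def policiesWithPeriod {R k : ℕ} (N : ℕ) (q : Queue R k → ℚ) : Set (Policy R k) :=
  {π | (∀ n, π (n + N) = π n) ∧
    ∀ i, q i = (((Finset.range N).filter fun n => π n = i).card : ℚ) / N}

/-- `n^*(q)`: the least positive integer `n` such that `n q` is an integer vector
(it is used for positive rational vectors `q` only). -/
def nStar {R k : ℕ} (q : Queue R k → ℚ) : ℕ :=
  sInf {n : ℕ | 0 < n ∧ ∀ i, ∃ m : ℕ, (n : ℚ) * q i = m}

/-- `𝒜_q(k)`: the `q`-policies, periodic with period `n^*(q)`. -/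
def qPolicies {R k : ℕ} (q : Queue R k → ℚ) : Set (Policy R k) :=
  policiesWithPeriod (nStar q) q

/-- `𝒫_p(k)`: positive rational proportions such that the fraction of jobs sent to the queues of
type `r`, all together, is `p r / ‖p‖`. -/
def proportions {R : ℕ} (p : Fin R → ℕ) (k : ℕ) : Set (Queue R k → ℚ) :=
  {q | (∀ i, 0 < q i) ∧ ∀ r, ∑ κ, q (r, κ) = (p r : ℚ) / (l1 p : ℚ)}

/-- The union of the sets `𝒜_q(k)` over `q ∈ 𝒫_p(k)`: the period is the least one, `n^*(q)`. -/
def minPeriodPolicies {R : ℕ} (p : Fin R → ℕ) (k : ℕ) : Set (Policy R k) :=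
  ⋃ q ∈ proportions p k, qPolicies q

/-- All periodic policies, of whatever period, whose proportions are in `𝒫_p(k)`. -/
def periodicPolicies {R : ℕ} (p : Fin R → ℕ) (k : ℕ) : Set (Policy R k) :=
  ⋃ q ∈ proportions p k, ⋃ N ∈ {N : ℕ | 0 < N}, policiesWithPeriod N q

/-- The `j`-th job (from `j = 0`) sent to some queue of type `r`. -/
def jobOfType {R k : ℕ} (π : Policy R k) (r : Fin R) (j : ℕ) : ℕ :=
  Nat.nth (fun n => (π n).1 = r) j

/-- `𝒞_p^{(k)}`: the sequence of types has period `‖p‖`, with `p r` jobs of type `r` per period, and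
the queues of each type are visited in round-robin order, starting from the first one. -/
def roundRobinPolicies {R : ℕ} (p : Fin R → ℕ) (k : ℕ) : Set (Policy R k) :=
  {π | π ∈ periodicPolicies p k ∧
    ((∀ n, (π (n + l1 p)).1 = (π n).1) ∧
      ∀ r, ((Finset.range (l1 p)).filter fun n => (π n).1 = r).card = p r) ∧
    ∀ r, ((π (jobOfType π r 0)).2 : ℕ) = 0 ∧
      ∀ j, ((π (jobOfType π r (j + 1))).2 : ℕ) =
        if ((π (jobOfType π r j)).2 : ℕ) + 1 < k then ((π (jobOfType π r j)).2 : ℕ) + 1 else 0}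

/-! ### The arrival process at a queue -/

/-- The period of a periodic policy. For a policy in `𝒜_q(k)`, this is `n^*(q)`. -/
def period {R k : ℕ} (π : Policy R k) : ℕ :=
  sInf {N : ℕ | 0 < N ∧ ∀ n, π (n + N) = π n}

/-- The number of jobs per period that are sent to queue `i`. -/
def jobsPerPeriod {R k : ℕ} (π : Policy R k) (i : Queue R k) : ℕ :=
  ((Finset.range (period π)).filter fun n => π n = i).card

/-- The index, at the dispatcher, of the `z`-th job sent to queue `i`, where the periodic
policy `π` is extended to jobs indexed by `ℤ` (job `z = 0` at queue `i` is the first one whose index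
at the dispatcher is nonnegative). -/
def arrivalIndex {R k : ℕ} (π : Policy R k) (i : Queue R k) (z : ℤ) : ℤ :=
  (Nat.nth (fun n => π n = i) (z % (jobsPerPeriod π i : ℤ)).toNat : ℤ) +
    (period π : ℤ) * (z / (jobsPerPeriod π i : ℤ))

/-- The two-sided stationary sequence of inter-arrival times at queue `i`. Here `T l` is the
time between jobs `l` and `l + 1` at the dispatcher, and `u` is the outcome of a variable uniform in
`[0, 1]`, which selects one of the inter-arrival times in the periodic pattern of queue `i`. -/
def interarrival {R k : ℕ} (π : Policy R k) (i : Queue R k) (u : ℝ) (T : ℤ → ℝ) (n : ℤ) : ℝ :=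
  ∑ l ∈ Finset.Ico (arrivalIndex π i (⌊u * (jobsPerPeriod π i : ℝ)⌋ + n - 1))
    (arrivalIndex π i (⌊u * (jobsPerPeriod π i : ℝ)⌋ + n)), T l

/-! ### Waiting times -/

/-- The stationary waiting time `(sup_{n ≥ 0} ∑_{n' = 0}^n (S_{-n'} - T_{-n'}))⁺ ∈ [0, ∞]` of a
first-come-first-served queue with service times `S` and inter-arrival times `T`. -/
def stationaryWait (S T : ℤ → ℝ) : ℝ≥0∞ :=
  ⨆ n : ℕ, ENNReal.ofReal (∑ n' ∈ Finset.range (n + 1), (S (-(n' : ℤ)) - T (-(n' : ℤ))))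

/-- The two arrival processes at the dispatcher. -/
inductive Arrivals
  | poisson
  | deterministic

/-- The law of the inter-arrival times at the dispatcher when jobs arrive with rate `a`. -/
def Arrivals.law : Arrivals → ℝ → Measure ℝ
  | .poisson, a => expMeasure a
  | .deterministic, a => Measure.dirac a⁻¹

/-- Outcomes `(V, U, T, S)`: the index `V` of a job of the first period, the phases `U i`, the
inter-arrival times `T n` at the dispatcher and the service times `S i n` at the queues. -/
abbrev Sample (R k : ℕ) :=
  ℕ × (Queue R k → ℝ) × (ℤ → ℝ) × (Queue R k → ℤ → ℝ)

/-- The joint law of `(V, U, T, S)`: everything is independent, `V` is uniform over one period,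
the `U i` are uniform in `[0, 1]`, the `T n` are the inter-arrival times of a stream of rate `a`, and
the service times at queue `(r, κ)` have law `ν r`. -/
def sampleLaw {R k : ℕ} (arr : Arrivals) (a : ℝ) (ν : Fin R → Measure ℝ) (π : Policy R k) :
    Measure (Sample R k) :=
  (uniformOn (Set.Iio (period π))).prod
    ((Measure.infinitePi fun _ : Queue R k => (volume : Measure ℝ).restrict (Set.Icc 0 1)).prod
      ((Measure.infinitePi fun _ : ℤ => arr.law a).prod
        (Measure.infinitePi fun i : Queue R k => Measure.infinitePi fun _ : ℤ => ν i.1)))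

/-- The stationary waiting time at queue `i`. -/
def queueWait {R k : ℕ} (π : Policy R k) (i : Queue R k) (ω : Sample R k) : ℝ≥0∞ :=
  stationaryWait (ω.2.2.2 i) (interarrival π i (ω.2.1 i) ω.2.2.1)

/-- The stationary waiting time of jobs, `W^{(k)}(π) = ∑ i, 1_{V ∈ Q_i} W_i^{(k)}(π)`, with the
partition `Q_i = {v | π v = i}` of one period. Its law is the mixture of the laws of the waiting
times at the queues, with the proportions of jobs sent to them as weights. -/
def wait {R k : ℕ} (π : Policy R k) (ω : Sample R k) : ℝ≥0∞ :=
  ∑ i, Set.indicator {ω' : Sample R k | π ω'.1 = i} (queueWait π i) ω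

/-- `𝔼 W^{(k)}(π)`, in `[0, ∞]`, when jobs arrive at the dispatcher with rate `a`. -/
def meanWait {R k : ℕ} (arr : Arrivals) (a : ℝ) (ν : Fin R → Measure ℝ) (π : Policy R k) : ℝ≥0∞ :=
  ∫⁻ ω, wait π ω ∂sampleLaw arr a ν π

/-! ### The limiting D/GI/1 queues -/

/-- `W_r(p)` as a function of the service times: inter-arrival times are `‖p‖ / (p_r lam)`. -/
def limitQueueWait {R : ℕ} (lam : ℝ) (p : Fin R → ℕ) (r : Fin R) (S : ℤ → ℝ) : ℝ≥0∞ :=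
  stationaryWait S fun _ => (l1 p : ℝ) / ((p r : ℝ) * lam)

/-- The law of i.i.d. service times of law `ν`. -/
def serviceLaw (ν : Measure ℝ) : Measure (ℤ → ℝ) := Measure.infinitePi fun _ : ℤ => ν

/-- `𝔼 W_r(p)`. -/
def limitQueueMean {R : ℕ} (lam : ℝ) (p : Fin R → ℕ) (ν : Fin R → Measure ℝ) (r : Fin R) : ℝ≥0∞ :=
  ∫⁻ S, limitQueueWait lam p r S ∂serviceLaw (ν r)

/-- The joint law of the random type, equal to `r` with probability `p_r / ‖p‖`, and of the
service times at `R` independent queues. -/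
def limitLaw {R : ℕ} (p : Fin R → ℕ) (ν : Fin R → Measure ℝ) :
    Measure (Fin R × (Fin R → ℤ → ℝ)) :=
  (∑ r, ((p r : ℝ≥0∞) / (l1 p : ℝ≥0∞)) • Measure.dirac r).prod
    (Measure.infinitePi fun r => serviceLaw (ν r))

/-- `W(p)`: the waiting time at the queue of random type. -/
def limitWait {R : ℕ} (lam : ℝ) (p : Fin R → ℕ) (ω : Fin R × (Fin R → ℤ → ℝ)) : ℝ≥0∞ :=
  limitQueueWait lam p ω.1 (ω.2 ω.1)

/-- `𝔼 W(p)`. -/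
def limitMean {R : ℕ} (lam : ℝ) (p : Fin R → ℕ) (ν : Fin R → Measure ℝ) : ℝ≥0∞ :=
  ∫⁻ ω, limitWait lam p ω ∂limitLaw p ν

end

end ParallelQueues

open ParallelQueues

namespace ParallelQueues

/-! ### The supremum of a random walk with negative drift -/

section RandomWalk

variable {ν : Measure ℝ} [IsProbabilityMeasure ν]

/-- Prepending an independent coordinate to an i.i.d. sequence. -/
lemma measurePreserving_cons :
    MeasurePreserving (fun z : ℝ × (ℕ → ℝ) => (fun n => Nat.casesOn n z.1 z.2 : ℕ → ℝ))
      (ν.prod (Measure.infinitePi fun _ : ℕ => ν)) (Measure.infinitePi fun _ : ℕ => ν) := by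
  have hm : Measurable (fun z : ℝ × (ℕ → ℝ) => (fun n => Nat.casesOn n z.1 z.2 : ℕ → ℝ)) := by
    refine measurable_pi_lambda _ fun n => ?_
    cases n with
    | zero => exact measurable_fst
    | succ n => exact (measurable_pi_apply n).comp measurable_snd
  refine ⟨hm, Measure.eq_infinitePi _ fun s t ht => ?_⟩
  classical
  set s' : Finset ℕ := s.preimage Nat.succ (Nat.succ_injective.injOn) with hs'
  have hpre : (fun z : ℝ × (ℕ → ℝ) => (fun n => Nat.casesOn n z.1 z.2 : ℕ → ℝ)) ⁻¹' (Set.pi s t)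
      = (if 0 ∈ s then t 0 else Set.univ) ×ˢ Set.pi (s' : Set ℕ) (fun n => t (n + 1)) := by
    ext z
    simp only [Set.mem_preimage, Set.mem_pi, Finset.mem_coe, Set.mem_prod, hs',
      Finset.mem_preimage]
    constructor
    · intro h
      refine ⟨?_, fun i hi => h (i + 1) hi⟩
      split_ifs with h0
      · exact h 0 h0
      · trivial
    · rintro ⟨h1, h2⟩ i hi
      cases i with
      | zero => simpa [hi] using h1
      | succ i => exact h2 i hi
  rw [Measure.map_apply hm (MeasurableSet.pi s.countable_toSet fun i _ => ht i), hpre,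
    Measure.prod_prod, Measure.infinitePi_pi _ (fun i _ => ht (i + 1))]
  have h2 : ∏ i ∈ s', ν (t (i + 1)) = ∏ n ∈ s, if n = 0 then 1 else ν (t n) := by
    have := Finset.prod_preimage Nat.succ s Nat.succ_injective.injOn
      (fun n => if n = 0 then 1 else ν (t n)) (by
        intro x _ hx
        have : x = 0 := by
          by_contra h
          exact hx ⟨x - 1, Nat.succ_pred_eq_of_pos (Nat.pos_of_ne_zero h)⟩
        simp [this])
    simpa using this
  have h1 : ν (if 0 ∈ s then t 0 else Set.univ) = ∏ n ∈ s, if n = 0 then ν (t n) else 1 := by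
    rw [Finset.prod_ite_eq']
    split_ifs <;> simp
  rw [h1, h2, ← Finset.prod_mul_distrib]
  refine Finset.prod_congr rfl fun n _ => ?_
  split_ifs <;> simp

/-- The supremum of the positive parts of the partial sums of a sequence. -/
noncomputable def pathSup (x : ℕ → ℝ) : ℝ≥0∞ :=
  ⨆ n : ℕ, ENNReal.ofReal (∑ i ∈ Finset.range (n + 1), x i)

/-- The maximum of `0` and the first `N` partial sums. -/
noncomputable def runMax : ℕ → (ℕ → ℝ) → ℝ
  | 0, _ => 0
  | N + 1, x => max 0 (x 0 + runMax N fun n => x (n + 1))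

lemma runMax_nonneg (N : ℕ) (x : ℕ → ℝ) : 0 ≤ runMax N x := by
  cases N with
  | zero => exact le_rfl
  | succ N => exact le_max_left _ _

lemma runMax_le_succ (N : ℕ) (x : ℕ → ℝ) : runMax N x ≤ runMax (N + 1) x := by
  induction N generalizing x with
  | zero => exact runMax_nonneg 1 x
  | succ N ih => exact max_le_max le_rfl (add_le_add le_rfl (ih _))

lemma sum_le_runMax (N : ℕ) (x : ℕ → ℝ) : ∑ i ∈ Finset.range N, x i ≤ runMax N x := by
  induction N generalizing x with
  | zero => simp [runMax]
  | succ N ih =>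
    rw [Finset.sum_range_succ', add_comm]
    exact (add_le_add le_rfl (ih _)).trans (le_max_right _ _)

lemma measurable_runMax (N : ℕ) : Measurable (runMax N) := by
  induction N with
  | zero => exact measurable_const
  | succ N ih =>
    exact measurable_const.max ((measurable_pi_apply 0).add
      (ih.comp (measurable_pi_lambda _ fun n => measurable_pi_apply (n + 1))))

lemma measurable_pathSup : Measurable pathSup :=
  Measurable.iSup fun _ => ENNReal.measurable_ofReal.comp
    (Finset.measurable_sum _ fun i _ => measurable_pi_apply i)

lemma lintegral_pathSup_pow_le {j : ℕ} (P : Measure (ℕ → ℝ)) (C : ℝ≥0∞)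
    (h : ∀ N, ∫⁻ x, ENNReal.ofReal (runMax N x ^ j) ∂P ≤ C) : ∫⁻ x, pathSup x ^ j ∂P ≤ C := by
  calc ∫⁻ x, pathSup x ^ j ∂P ≤ ∫⁻ x, ⨆ N, ENNReal.ofReal (runMax N x ^ j) ∂P := by
        refine lintegral_mono fun x => ?_
        rw [pathSup, ENNReal.iSup_pow]
        refine iSup_le fun n => le_iSup_of_le (n + 1) ?_
        rw [ENNReal.ofReal_pow (runMax_nonneg _ _)]
        gcongr
        exact sum_le_runMax (n + 1) x
    _ = ⨆ N, ∫⁻ x, ENNReal.ofReal (runMax N x ^ j) ∂P := by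
        refine lintegral_iSup (fun N => ((measurable_runMax N).pow_const j).ennreal_ofReal) ?_
        refine monotone_nat_of_le_succ fun N x => ?_
        exact ENNReal.ofReal_le_ofReal
          (pow_le_pow_left₀ (runMax_nonneg _ _) (runMax_le_succ N x) j)
    _ ≤ C := iSup_le h

lemma memLp_runMax {q : ℝ≥0∞} (h : MemLp (fun x : ℝ => x) q ν) (N : ℕ) :
    MemLp (runMax N) q (Measure.infinitePi fun _ : ℕ => ν) := by
  induction N with
  | zero => exact MemLp.zero
  | succ N ih =>
    rw [← (measurePreserving_cons (ν := ν)).map_eq,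
      memLp_map_measure_iff (measurable_runMax _).aestronglyMeasurable
        (measurePreserving_cons (ν := ν)).measurable.aemeasurable]
    have hs : MemLp (fun z : ℝ × (ℕ → ℝ) => z.1 + runMax N z.2) q
        (ν.prod (Measure.infinitePi fun _ : ℕ => ν)) := (h.comp_fst _).add (ih.comp_snd _)
    refine hs.mono ((measurable_runMax _).comp
      (measurePreserving_cons (ν := ν)).measurable).aestronglyMeasurable (ae_of_all _ fun z => ?_)
    simp only [Function.comp, runMax, Real.norm_eq_abs]
    rw [abs_of_nonneg (le_max_left _ _)]
    exact max_le (abs_nonneg _) (le_abs_self _)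

lemma integral_runMax_succ_pow (N j : ℕ) :
    ∫ x, runMax (N + 1) x ^ j ∂(Measure.infinitePi fun _ : ℕ => ν) =
      ∫ z, (max 0 (z.1 + runMax N z.2)) ^ j ∂(ν.prod (Measure.infinitePi fun _ : ℕ => ν)) := by
  rw [← (measurePreserving_cons (ν := ν)).map_eq, integral_map
    (measurePreserving_cons (ν := ν)).measurable.aemeasurable
    ((measurable_runMax _).pow_const j).aestronglyMeasurable]
  rw [(measurePreserving_cons (ν := ν)).map_eq]
  rfl

lemma integral_runMax_le {δ : ℝ} (hδ : 0 < δ) (h : MemLp (fun x : ℝ => x) 2 ν)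
    (hmean : ∫ x, x ∂ν = -δ) (N : ℕ) :
    ∫ x, runMax N x ∂(Measure.infinitePi fun _ : ℕ => ν) ≤ (∫ x, x ^ 2 ∂ν) / (2 * δ) := by
  set P := Measure.infinitePi fun _ : ℕ => ν
  have hM := memLp_runMax h N
  have hM1 := memLp_runMax h (N + 1)
  have i1 : Integrable (fun z : ℝ × (ℕ → ℝ) => z.1 ^ 2) (ν.prod P) := h.integrable_sq.comp_fst P
  have i2 : Integrable (fun z : ℝ × (ℕ → ℝ) => z.1 * runMax N z.2) (ν.prod P) :=
    (h.integrable (by norm_num)).mul_prod (hM.integrable (by norm_num))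
  have i3 : Integrable (fun z : ℝ × (ℕ → ℝ) => runMax N z.2 ^ 2) (ν.prod P) :=
    hM.integrable_sq.comp_snd ν
  have mono : ∫ x, runMax N x ^ 2 ∂P ≤ ∫ x, runMax (N + 1) x ^ 2 ∂P :=
    integral_mono hM.integrable_sq hM1.integrable_sq fun x =>
      pow_le_pow_left₀ (runMax_nonneg _ _) (runMax_le_succ N x) 2
  have step : ∫ x, runMax (N + 1) x ^ 2 ∂P ≤
      ∫ z, (z.1 ^ 2 + 2 * (z.1 * runMax N z.2) + runMax N z.2 ^ 2) ∂(ν.prod P) := by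
    rw [integral_runMax_succ_pow]
    refine integral_mono_of_nonneg (ae_of_all _ fun z => by positivity)
      ((i1.add (i2.const_mul 2)).add i3) (ae_of_all _ fun z => ?_)
    have : (max 0 (z.1 + runMax N z.2)) ^ 2 ≤ (z.1 + runMax N z.2) ^ 2 := by
      rw [sq_le_sq, abs_of_nonneg (le_max_left _ _)]
      exact max_le (abs_nonneg _) (le_abs_self _)
    exact this.trans (le_of_eq (by ring))
  have e1 : ∫ z, (z.1 ^ 2 + 2 * (z.1 * runMax N z.2) + runMax N z.2 ^ 2) ∂(ν.prod P) =
      ∫ x, x ^ 2 ∂ν + 2 * (-δ * ∫ x, runMax N x ∂P) + ∫ x, runMax N x ^ 2 ∂P := by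
    have i12 : Integrable (fun z : ℝ × (ℕ → ℝ) => z.1 ^ 2 + 2 * (z.1 * runMax N z.2))
      (ν.prod P) := i1.add (i2.const_mul 2)
    rw [integral_add i12 i3, integral_add i1 (i2.const_mul 2),
      integral_const_mul, integral_prod_mul (fun x : ℝ => x) (runMax N), hmean,
      integral_fun_fst (fun x : ℝ => x ^ 2), integral_fun_snd (fun x => runMax N x ^ 2)]
    simp
  rw [le_div_iff₀ (by positivity)]
  nlinarith [mono.trans (step.trans_eq e1)]

lemma integral_runMax_sq_le {δ : ℝ} (hδ : 0 < δ) (h : MemLp (fun x : ℝ => x) 3 ν)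
    (hmean : ∫ x, x ∂ν = -δ) (N : ℕ) :
    ∫ x, runMax N x ^ 2 ∂(Measure.infinitePi fun _ : ℕ => ν) ≤
      ((∫ x, x ^ 2 ∂ν) ^ 2 / (2 * δ) + ∫ x, |x| ^ 3 ∂ν) / δ := by
  set P := Measure.infinitePi fun _ : ℕ => ν
  have h2 : MemLp (fun x : ℝ => x) 2 ν := h.mono_exponent (by norm_num)
  have hM := memLp_runMax h N
  have hM1 := memLp_runMax h (N + 1)
  have hM2 : MemLp (runMax N) 2 P := hM.mono_exponent (by norm_num)
  have cube : ∀ {N}, MemLp (runMax N) 3 P → Integrable (fun x => runMax N x ^ 3) P := by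
    intro N hN
    have := hN.integrable_norm_pow (p := 3) (by norm_num)
    refine this.congr (ae_of_all _ fun x => ?_)
    simp [abs_of_nonneg (runMax_nonneg N x)]
  have c1 : Integrable (fun x : ℝ => |x| ^ 3) ν := by
    simpa using h.integrable_norm_pow (p := 3) (by norm_num)
  have i0 : Integrable (fun z : ℝ × (ℕ → ℝ) => |z.1| ^ 3) (ν.prod P) := c1.comp_fst P
  have i1 : Integrable (fun z : ℝ × (ℕ → ℝ) => z.1 ^ 2 * runMax N z.2) (ν.prod P) :=
    h2.integrable_sq.mul_prod (hM.integrable (by norm_num))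
  have i2 : Integrable (fun z : ℝ × (ℕ → ℝ) => z.1 * runMax N z.2 ^ 2) (ν.prod P) :=
    (h.integrable (by norm_num)).mul_prod hM2.integrable_sq
  have i3 : Integrable (fun z : ℝ × (ℕ → ℝ) => runMax N z.2 ^ 3) (ν.prod P) :=
    (cube hM).comp_snd ν
  have mono : ∫ x, runMax N x ^ 3 ∂P ≤ ∫ x, runMax (N + 1) x ^ 3 ∂P :=
    integral_mono (cube hM) (cube hM1) fun x =>
      pow_le_pow_left₀ (runMax_nonneg _ _) (runMax_le_succ N x) 3
  have step : ∫ x, runMax (N + 1) x ^ 3 ∂P ≤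
      ∫ z, (2 * |z.1| ^ 3 + 3 * (z.1 ^ 2 * runMax N z.2) + 3 * (z.1 * runMax N z.2 ^ 2) +
        runMax N z.2 ^ 3) ∂(ν.prod P) := by
    rw [integral_runMax_succ_pow]
    refine integral_mono_of_nonneg (ae_of_all _ fun z => by positivity)
      ((((i0.const_mul 2).add (i1.const_mul 3)).add (i2.const_mul 3)).add i3)
      (ae_of_all _ fun z => ?_)
    have hm := runMax_nonneg N z.2
    set m := runMax N z.2
    have key : (max 0 (z.1 + m)) ^ 3 ≤ (z.1 + m) ^ 3 + |z.1| ^ 3 := by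
      rcases le_total 0 (z.1 + m) with h0 | h0
      · rw [max_eq_right h0]
        linarith [pow_nonneg (abs_nonneg z.1) 3]
      · rw [max_eq_left h0]
        have ha : |z.1| = -z.1 := abs_of_nonpos (by linarith)
        rw [ha]
        have : (-(z.1 + m)) ^ 3 ≤ (-z.1) ^ 3 := pow_le_pow_left₀ (by linarith) (by linarith) 3
        nlinarith
    have hz : z.1 ^ 3 ≤ |z.1| ^ 3 := by
      rw [← abs_pow]
      exact le_abs_self _
    refine key.trans ?_
    show _ ≤ 2 * |z.1| ^ 3 + 3 * (z.1 ^ 2 * m) + 3 * (z.1 * m ^ 2) + m ^ 3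
    nlinarith
  have e1 : ∫ z, (2 * |z.1| ^ 3 + 3 * (z.1 ^ 2 * runMax N z.2) + 3 * (z.1 * runMax N z.2 ^ 2) +
        runMax N z.2 ^ 3) ∂(ν.prod P) =
      2 * ∫ x, |x| ^ 3 ∂ν + 3 * ((∫ x, x ^ 2 ∂ν) * ∫ x, runMax N x ∂P) +
        3 * (-δ * ∫ x, runMax N x ^ 2 ∂P) + ∫ x, runMax N x ^ 3 ∂P := by
    have i01 : Integrable (fun z : ℝ × (ℕ → ℝ) => 2 * |z.1| ^ 3 + 3 * (z.1 ^ 2 * runMax N z.2))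
      (ν.prod P) := (i0.const_mul 2).add (i1.const_mul 3)
    have i012 : Integrable (fun z : ℝ × (ℕ → ℝ) => 2 * |z.1| ^ 3 +
        3 * (z.1 ^ 2 * runMax N z.2) + 3 * (z.1 * runMax N z.2 ^ 2)) (ν.prod P) :=
      i01.add (i2.const_mul 3)
    rw [integral_add i012 i3, integral_add i01 (i2.const_mul 3),
      integral_add (i0.const_mul 2) (i1.const_mul 3),
      integral_const_mul, integral_const_mul, integral_const_mul,
      integral_prod_mul (fun x : ℝ => x) (fun x => runMax N x ^ 2), hmean,
      integral_prod_mul (fun x : ℝ => x ^ 2) (runMax N),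
      integral_fun_fst (fun x : ℝ => |x| ^ 3), integral_fun_snd (fun x => runMax N x ^ 3)]
    simp
  have hfirst := integral_runMax_le hδ h2 hmean N
  have hsq : 0 ≤ ∫ x, x ^ 2 ∂ν := integral_nonneg fun x => sq_nonneg x
  have hprod := mul_le_mul_of_nonneg_left hfirst hsq
  have habs : 0 ≤ ∫ x, |x| ^ 3 ∂ν := integral_nonneg fun x => by positivity
  have e2 : (∫ x, x ^ 2 ∂ν) * ((∫ x, x ^ 2 ∂ν) / (2 * δ)) = (∫ x, x ^ 2 ∂ν) ^ 2 / (2 * δ) := by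
    ring
  rw [e2] at hprod
  rw [le_div_iff₀ hδ]
  nlinarith [mono.trans (step.trans_eq e1)]

lemma lintegral_pathSup_le {δ : ℝ} (hδ : 0 < δ) (h : MemLp (fun x : ℝ => x) 2 ν)
    (hmean : ∫ x, x ∂ν = -δ) :
    ∫⁻ x, pathSup x ^ 1 ∂(Measure.infinitePi fun _ : ℕ => ν) ≤
      ENNReal.ofReal ((∫ x, x ^ 2 ∂ν) / (2 * δ)) := by
  refine lintegral_pathSup_pow_le _ _ fun N => ?_
  simp only [pow_one]
  rw [← ofReal_integral_eq_lintegral_ofReal ((memLp_runMax h N).integrable (by norm_num))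
    (ae_of_all _ (runMax_nonneg N))]
  exact ENNReal.ofReal_le_ofReal (integral_runMax_le hδ h hmean N)

lemma lintegral_pathSup_sq_le {δ : ℝ} (hδ : 0 < δ) (h : MemLp (fun x : ℝ => x) 3 ν)
    (hmean : ∫ x, x ∂ν = -δ) :
    ∫⁻ x, pathSup x ^ 2 ∂(Measure.infinitePi fun _ : ℕ => ν) ≤
      ENNReal.ofReal (((∫ x, x ^ 2 ∂ν) ^ 2 / (2 * δ) + ∫ x, |x| ^ 3 ∂ν) / δ) := by
  refine lintegral_pathSup_pow_le _ _ fun N => ?_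
  rw [← ofReal_integral_eq_lintegral_ofReal
    ((memLp_runMax (h.mono_exponent (by norm_num) : MemLp (fun x : ℝ => x) 2 ν) N).integrable_sq)
    (ae_of_all _ fun x => sq_nonneg _)]
  exact ENNReal.ofReal_le_ofReal (integral_runMax_sq_le hδ h hmean N)

end RandomWalk

/-! ### Reindexing i.i.d. sequences -/

lemma lintegral_pathSup_reindex {ν : Measure ℝ} [IsProbabilityMeasure ν] {f : ℕ → ℤ}
    (hf : Function.Injective f) {g : ℝ → ℝ} (hg : Measurable g) (j : ℕ) :
    ∫⁻ x, pathSup (fun n => g (x (f n))) ^ j ∂(Measure.infinitePi fun _ : ℤ => ν) =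
      ∫⁻ x, pathSup x ^ j ∂(Measure.infinitePi fun _ : ℕ => ν.map g) := by
  have h1 : (Measure.infinitePi fun _ : ℤ => ν).map (fun x n => x (f n)) =
      Measure.infinitePi fun _ : ℕ => ν :=
    Measure.map_infinitePi_infinitePi_of_inj (P := fun _ : ℤ => ν) hf
  have h2 : (Measure.infinitePi fun _ : ℕ => ν).map (fun x n => g (x n)) =
      Measure.infinitePi fun _ : ℕ => ν.map g :=
    Measure.infinitePi_map_pi (fun _ : ℕ => ν) (f := fun _ => g) (fun _ => hg)
  have m1 : Measurable fun (x : ℤ → ℝ) n => x (f n) :=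
    measurable_pi_lambda _ fun n => measurable_pi_apply _
  have m2 : Measurable fun (x : ℕ → ℝ) n => g (x n) :=
    measurable_pi_lambda _ fun n => hg.comp (measurable_pi_apply _)
  rw [← h2, ← h1, lintegral_map (measurable_pathSup.pow_const j) m2,
    lintegral_map (f := fun x : ℕ → ℝ => pathSup (fun n => g (x n)) ^ j)
      ((measurable_pathSup.pow_const j).comp m2) m1]

lemma stationaryWait_eq_pathSup (S T : ℤ → ℝ) :
    stationaryWait S T = pathSup fun n => S (-(n : ℤ)) - T (-(n : ℤ)) := rfl

lemma memLp_three_of_integrable_cube {ν : Measure ℝ} (h : Integrable (fun x => x ^ 3) ν) :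
    MemLp (fun x : ℝ => x) 3 ν := by
  refine (integrable_norm_rpow_iff aestronglyMeasurable_id (by norm_num) (by norm_num)).1 ?_
  refine h.norm.congr (ae_of_all _ fun x => ?_)
  have : (3 : ℝ≥0∞).toReal = ((3 : ℕ) : ℝ) := by norm_num
  simp only [this, Real.rpow_natCast, norm_pow, id]

lemma memLp_map {ν : Measure ℝ} {g : ℝ → ℝ} (hg : Measurable g) {q : ℝ≥0∞} (h : MemLp g q ν) :
    MemLp (fun x : ℝ => x) q (ν.map g) :=
  (memLp_map_measure_iff aestronglyMeasurable_id hg.aemeasurable).2 h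

/-- The waiting time of a stable D/GI/1 queue has a finite moment of order one less than the
service times. -/
lemma lintegral_stationaryWait_const_ne_top {ν : Measure ℝ} [IsProbabilityMeasure ν]
    (h : MemLp (fun x : ℝ => x) 3 ν) {t : ℝ} (ht : ∫ x, x ∂ν < t) {j : ℕ} (hj : j = 1 ∨ j = 2) :
    ∫⁻ S, stationaryWait S (fun _ => t) ^ j ∂serviceLaw ν ≠ ∞ := by
  have hg : Measurable fun x : ℝ => x - t := measurable_id.sub_const t
  have hinj : Function.Injective fun n : ℕ => -(n : ℤ) := fun a b hab => by simpa using hab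
  have hmem : MemLp (fun x : ℝ => x - t) 3 ν := h.sub (memLp_const t)
  have hmean : ∫ x, x ∂(ν.map fun x => x - t) = -(t - ∫ x, x ∂ν) := by
    rw [integral_map hg.aemeasurable (f := fun x => x) aestronglyMeasurable_id,
      integral_sub (h.integrable (by norm_num)) (integrable_const t)]
    simp
  have : IsProbabilityMeasure (ν.map fun x => x - t) :=
    Measure.isProbabilityMeasure_map hg.aemeasurable
  simp only [stationaryWait_eq_pathSup, serviceLaw]
  rw [lintegral_pathSup_reindex (g := fun x => x - t) hinj hg j]
  rcases hj with rfl | rfl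
  · exact ne_top_of_le_ne_top ENNReal.ofReal_ne_top (lintegral_pathSup_le (by linarith)
      ((memLp_map hg hmem).mono_exponent (by norm_num)) hmean)
  · exact ne_top_of_le_ne_top ENNReal.ofReal_ne_top (lintegral_pathSup_sq_le (by linarith)
      (memLp_map hg hmem) hmean)

/-! ### Moments of the inter-arrival times at the dispatcher -/

lemma integral_pow_expMeasure {a : ℝ} (ha : 0 < a) (n : ℕ) :
    ∫ x, x ^ n ∂expMeasure a = n.factorial / a ^ n := by
  have hm : Measurable (gammaPDF 1 a) := (measurable_gammaPDFReal 1 a).ennreal_ofReal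
  rw [expMeasure, gammaMeasure, integral_withDensity_eq_integral_toReal_smul hm
    (ae_of_all _ fun x => ENNReal.ofReal_lt_top)]
  have : ∀ x, (gammaPDF 1 a x).toReal • x ^ n = Set.indicator (Set.Ici 0)
      (fun x => a * (x ^ (((n : ℝ) + 1) - 1) * Real.exp (-(a * x)))) x := by
    intro x
    rw [gammaPDF, ENNReal.toReal_ofReal (gammaPDFReal_nonneg one_pos ha x)]
    by_cases hx : 0 ≤ x
    · rw [Set.indicator_of_mem (Set.mem_Ici.2 hx)]
      simp [gammaPDFReal, hx]
      ring
    · rw [Set.indicator_of_notMem (by simpa using hx)]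
      simp [gammaPDFReal, hx]
  simp_rw [this]
  rw [integral_indicator measurableSet_Ici, integral_Ici_eq_integral_Ioi, integral_const_mul,
    Real.integral_rpow_mul_exp_neg_mul_Ioi (by positivity) ha, Real.Gamma_nat_eq_factorial,
    ← Nat.cast_succ, Real.rpow_natCast,
    one_div, inv_pow, pow_succ]
  field_simp

lemma integrable_pow_expMeasure {a : ℝ} (ha : 0 < a) (n : ℕ) :
    Integrable (fun x : ℝ => x ^ n) (expMeasure a) := by
  refine Integrable.of_integral_ne_zero ?_
  rw [integral_pow_expMeasure ha]
  positivity

lemma ae_nonneg_expMeasure {a : ℝ} : ∀ᵐ x ∂expMeasure a, 0 ≤ x := by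
  have hm : Measurable (gammaPDF 1 a) := (measurable_gammaPDFReal 1 a).ennreal_ofReal
  rw [expMeasure, gammaMeasure, ae_withDensity_iff hm]
  refine ae_of_all _ fun x hx => ?_
  by_contra h
  exact hx (gammaPDF_of_neg (not_le.1 h))

section Law

variable (arr : Arrivals) {a : ℝ}

lemma isProbabilityMeasure_law (ha : 0 < a) : IsProbabilityMeasure (arr.law a) := by
  cases arr with
  | poisson => exact isProbabilityMeasure_expMeasure ha
  | deterministic => exact Measure.dirac.isProbabilityMeasure

lemma memLp_law (ha : 0 < a) : MemLp (fun x : ℝ => x) 3 (arr.law a) := by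
  refine memLp_three_of_integrable_cube ?_
  cases arr with
  | poisson => exact integrable_pow_expMeasure ha 3
  | deterministic => exact integrable_dirac (by simp)

lemma ae_nonneg_law (ha : 0 < a) : ∀ᵐ x ∂arr.law a, 0 ≤ x := by
  cases arr with
  | poisson => exact ae_nonneg_expMeasure
  | deterministic =>
    rw [Arrivals.law, ae_dirac_eq]
    exact (inv_pos.2 ha).le

lemma integral_law (ha : 0 < a) : ∫ x, x ∂arr.law a = 1 / a := by
  cases arr with
  | poisson => simpa [Arrivals.law] using integral_pow_expMeasure ha 1
  | deterministic => simp [Arrivals.law]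

lemma integral_sq_law_le (ha : 0 < a) : ∫ x, x ^ 2 ∂arr.law a ≤ 2 / a ^ 2 := by
  cases arr with
  | poisson => exact (integral_pow_expMeasure ha 2).trans_le (by simp [Nat.factorial])
  | deterministic =>
    simp only [Arrivals.law, integral_dirac, inv_pow, div_eq_mul_inv]
    have : 0 < a⁻¹ := inv_pos.2 ha
    rw [← inv_pow]
    nlinarith [pow_pos this 2, pow_pos this 3]

lemma integral_cube_law_le (ha : 0 < a) : ∫ x, x ^ 3 ∂arr.law a ≤ 6 / a ^ 3 := by
  cases arr with
  | poisson => exact (integral_pow_expMeasure ha 3).trans_le (by simp [Nat.factorial])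
  | deterministic =>
    simp only [Arrivals.law, integral_dirac, inv_pow, div_eq_mul_inv]
    have : 0 < a⁻¹ := inv_pos.2 ha
    rw [← inv_pow]
    nlinarith [pow_pos this 2, pow_pos this 3]

/-- When jobs arrive at rate `a`, the amount by which the arrivals ever lag behind a stream of the
smaller rate `a / ρ` is of order `1 / a`. -/
lemma exists_lintegral_lag_le {ρ : ℝ} (hρ0 : 0 ≤ ρ) (hρ : ρ < 1) {j : ℕ} (hj : j = 1 ∨ j = 2) :
    ∃ K : ℝ, ∀ a : ℝ, 0 < a → ∀ A : ℤ,
      ∫⁻ T, pathSup (fun n => ρ / a - T (A - 1 - n)) ^ j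
        ∂(Measure.infinitePi fun _ : ℤ => arr.law a) ≤ ENNReal.ofReal (K / a ^ j) := by
  have hρ1 : 0 < 1 - ρ := by linarith
  have main : ∀ a : ℝ, 0 < a → ∀ A : ℤ,
      (∫⁻ T, pathSup (fun n => ρ / a - T (A - 1 - n)) ^ 1
        ∂(Measure.infinitePi fun _ : ℤ => arr.law a) ≤
          ENNReal.ofReal (3 / (2 * (1 - ρ)) / a ^ 1)) ∧
      (∫⁻ T, pathSup (fun n => ρ / a - T (A - 1 - n)) ^ 2
        ∂(Measure.infinitePi fun _ : ℤ => arr.law a) ≤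
          ENNReal.ofReal ((9 / (2 * (1 - ρ)) + 16) / (1 - ρ) / a ^ 2)) := by
    intro a ha A
    have := isProbabilityMeasure_law arr ha
    have hg : Measurable fun x : ℝ => ρ / a - x := measurable_const.sub measurable_id
    have : IsProbabilityMeasure ((arr.law a).map fun x => ρ / a - x) :=
      Measure.isProbabilityMeasure_map hg.aemeasurable
    have hinj : Function.Injective fun n : ℕ => A - 1 - (n : ℤ) := fun x y hxy => by
      simpa using hxy
    have h3 := memLp_law arr ha
    have h2 : MemLp (fun x : ℝ => x) 2 (arr.law a) := h3.mono_exponent (by norm_num)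
    have h1 : Integrable (fun x : ℝ => x) (arr.law a) := h3.integrable (by norm_num)
    have hsq := h2.integrable_sq
    have hcube : Integrable (fun x : ℝ => x ^ 3) (arr.law a) := by
      have := h3.integrable_norm_pow (p := 3) (by norm_num)
      refine this.congr ?_
      filter_upwards [ae_nonneg_law arr ha] with x hx
      simp [abs_of_nonneg hx]
    have hmem : MemLp (fun x : ℝ => ρ / a - x) 3 (arr.law a) := (memLp_const _).sub h3
    have hmean : ∫ x, x ∂((arr.law a).map fun x => ρ / a - x) = -((1 - ρ) / a) := by
      rw [integral_map hg.aemeasurable (f := fun x => x) aestronglyMeasurable_id,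
        integral_sub (integrable_const _) h1, integral_law arr ha]
      simp
      ring
    have hδ : 0 < (1 - ρ) / a := by positivity
    have e2 : ∫ x, x ^ 2 ∂((arr.law a).map fun x => ρ / a - x) ≤ 3 / a ^ 2 := by
      rw [integral_map hg.aemeasurable (by fun_prop)]
      have : ∫ x, (ρ / a - x) ^ 2 ∂arr.law a ≤ ∫ x, ((1 / a) ^ 2 + x ^ 2) ∂arr.law a := by
        refine integral_mono_of_nonneg (ae_of_all _ fun x => by positivity)
          ((integrable_const _).add hsq) ?_
        filter_upwards [ae_nonneg_law arr ha] with x hx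
        have h0 : 0 ≤ ρ / a := by positivity
        have h1 : ρ / a ≤ 1 / a := by gcongr
        nlinarith [mul_nonneg h0 hx, mul_nonneg h0 h0]
      refine this.trans ?_
      rw [integral_add (integrable_const _) hsq]
      have := integral_sq_law_le arr ha
      simp only [integral_const, probReal_univ, one_smul]
      calc (1 / a) ^ 2 + ∫ x, x ^ 2 ∂arr.law a ≤ (1 / a) ^ 2 + 2 / a ^ 2 := by gcongr
        _ = 3 / a ^ 2 := by field_simp; norm_num
    have e3 : ∫ x, |x| ^ 3 ∂((arr.law a).map fun x => ρ / a - x) ≤ 16 / a ^ 3 := by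
      rw [integral_map hg.aemeasurable (by fun_prop)]
      have hi : Integrable (fun x : ℝ => (1 / a) ^ 3 + 3 * (1 / a) ^ 2 * x + 3 * (1 / a) * x ^ 2)
        (arr.law a) := ((integrable_const _).add (h1.const_mul _)).add (hsq.const_mul _)
      have hi' : Integrable (fun x : ℝ => (1 / a) ^ 3 + 3 * (1 / a) ^ 2 * x)
        (arr.law a) := (integrable_const _).add (h1.const_mul _)
      have : ∫ x, |ρ / a - x| ^ 3 ∂arr.law a ≤
          ∫ x, ((1 / a) ^ 3 + 3 * (1 / a) ^ 2 * x + 3 * (1 / a) * x ^ 2 + x ^ 3) ∂arr.law a := by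
        refine integral_mono_of_nonneg (ae_of_all _ fun x => by positivity)
          (hi.add hcube) ?_
        filter_upwards [ae_nonneg_law arr ha] with x hx
        have h0 : 0 ≤ ρ / a := by positivity
        have h1 : ρ / a ≤ 1 / a := by gcongr
        have : |ρ / a - x| ≤ 1 / a + x := by
          rw [abs_le]
          constructor <;> linarith
        calc |ρ / a - x| ^ 3 ≤ (1 / a + x) ^ 3 := pow_le_pow_left₀ (abs_nonneg _) this 3
          _ = _ := by ring
      refine this.trans ?_
      rw [integral_add hi hcube, integral_add hi' (hsq.const_mul _),
        integral_add (integrable_const _) (h1.const_mul _), integral_const_mul,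
        integral_const_mul, integral_law arr ha]
      have i2 := integral_sq_law_le arr ha
      have i3 := integral_cube_law_le arr ha
      simp only [integral_const, probReal_univ, one_smul]
      calc (1 / a) ^ 3 + 3 * (1 / a) ^ 2 * (1 / a) + 3 * (1 / a) * ∫ x, x ^ 2 ∂arr.law a +
            ∫ x, x ^ 3 ∂arr.law a ≤ (1 / a) ^ 3 + 3 * (1 / a) ^ 2 * (1 / a) +
              3 * (1 / a) * (2 / a ^ 2) + 6 / a ^ 3 := by gcongr
        _ = 16 / a ^ 3 := by field_simp; norm_num
    have sq0 : 0 ≤ ∫ x, x ^ 2 ∂((arr.law a).map fun x => ρ / a - x) :=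
      integral_nonneg fun x => sq_nonneg x
    rw [lintegral_pathSup_reindex (g := fun x => ρ / a - x) hinj hg,
      lintegral_pathSup_reindex (g := fun x => ρ / a - x) hinj hg]
    refine ⟨(lintegral_pathSup_le hδ ((memLp_map hg hmem).mono_exponent (by norm_num))
      hmean).trans (ENNReal.ofReal_le_ofReal ?_), (lintegral_pathSup_sq_le hδ (memLp_map hg hmem)
      hmean).trans (ENNReal.ofReal_le_ofReal ?_)⟩
    · calc _ ≤ (3 / a ^ 2) / (2 * ((1 - ρ) / a)) := by gcongr
        _ = _ := by field_simp
    · calc _ ≤ ((3 / a ^ 2) ^ 2 / (2 * ((1 - ρ) / a)) + 16 / a ^ 3) / ((1 - ρ) / a) := by gcongr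
        _ = _ := by field_simp; norm_num
  rcases hj with rfl | rfl
  · exact ⟨_, fun a ha A => (main a ha A).1⟩
  · exact ⟨_, fun a ha A => (main a ha A).2⟩

end Law

/-! ### Periodic predicates and periodic policies -/

section Periodic

variable {P : ℕ → Prop} [DecidablePred P] {N : ℕ}

lemma count_add_period (h : ∀ n, P (n + N) ↔ P n) (b : ℕ) :
    Nat.count P (b + N) = Nat.count P b + Nat.count P N := by
  have h' : ∀ k, P (N + k) ↔ P k := fun k => by rw [add_comm, h]
  rw [add_comm b N, Nat.count_add, add_comm]
  rw [Nat.count_eq_card_filter_range (fun k => P (N + k)), Nat.count_eq_card_filter_range P b,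
    Finset.filter_congr fun k _ => h' k]

lemma count_add_mul_period (h : ∀ n, P (n + N) ↔ P n) (b c : ℕ) :
    Nat.count P (b + N * c) = Nat.count P b + Nat.count P N * c := by
  induction c with
  | zero => simp
  | succ c ih => rw [Nat.mul_succ, ← add_assoc, count_add_period h, ih, Nat.mul_succ, add_assoc]

/-- The density of a periodic predicate does not depend on the period. -/
lemma count_mul_eq_count_mul {N' : ℕ} (h : ∀ n, P (n + N) ↔ P n) (h' : ∀ n, P (n + N') ↔ P n) :
    Nat.count P N * N' = Nat.count P N' * N := by
  have e1 := count_add_mul_period h 0 N'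
  have e2 := count_add_mul_period h' 0 N
  rw [mul_comm N' N, e1] at e2
  simpa using e2

lemma infinite_of_count_pos (h : ∀ n, P (n + N) ↔ P n) (hm : 0 < Nat.count P N) :
    (Set.ofPred P).Infinite := by
  by_contra hf
  rw [Set.not_infinite] at hf
  have hb : ∀ n, Nat.count P n ≤ hf.toFinset.card := fun n => by
    rw [Nat.count_eq_card_filter_range]
    refine Finset.card_le_card fun x hx => ?_
    rw [Set.Finite.mem_toFinset]
    exact (Finset.mem_filter.1 hx).2
  have := hb (0 + N * (hf.toFinset.card + 1))
  rw [count_add_mul_period h] at this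
  nlinarith

lemma nth_add_count (h : ∀ n, P (n + N) ↔ P n) (hm : 0 < Nat.count P N) (z : ℕ) :
    Nat.nth P (z + Nat.count P N) = Nat.nth P z + N := by
  have hinf := infinite_of_count_pos h hm
  have hP : P (Nat.nth P z + N) := (h _).2 (Nat.nth_mem_of_infinite hinf z)
  rw [← Nat.nth_count hP, count_add_period h, Nat.count_nth_of_infinite hinf]

lemma nth_add_count_mul (h : ∀ n, P (n + N) ↔ P n) (hm : 0 < Nat.count P N) (z c : ℕ) :
    Nat.nth P (z + Nat.count P N * c) = Nat.nth P z + N * c := by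
  induction c with
  | zero => simp
  | succ c ih => rw [Nat.mul_succ, ← add_assoc, nth_add_count h hm, ih, Nat.mul_succ, add_assoc]

end Periodic

section Policy

variable {R k : ℕ} {σ : Policy R k} {i : Queue R k}

lemma period_mem (h : ∃ N, 0 < N ∧ ∀ n, σ (n + N) = σ n) :
    0 < period σ ∧ ∀ n, σ (n + period σ) = σ n :=
  Nat.sInf_mem (s := {N : ℕ | 0 < N ∧ ∀ n, σ (n + N) = σ n}) h

lemma jobsPerPeriod_eq_count : jobsPerPeriod σ i = Nat.count (fun n => σ n = i) (period σ) := by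
  rw [Nat.count_eq_card_filter_range, jobsPerPeriod]

lemma visits_periodic (h : ∃ N, 0 < N ∧ ∀ n, σ (n + N) = σ n) (n : ℕ) :
    σ (n + period σ) = i ↔ σ n = i := by rw [(period_mem h).2 n]

/-- The proportion of jobs sent to a queue, computed with any period. -/
lemma jobsPerPeriod_mul {M : ℕ} (hM : 0 < M) (h : ∀ n, σ (n + M) = σ n) :
    jobsPerPeriod σ i * M = Nat.count (fun n => σ n = i) M * period σ := by
  rw [jobsPerPeriod_eq_count]
  exact count_mul_eq_count_mul (P := fun n => σ n = i) (visits_periodic ⟨M, hM, h⟩)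
    fun n => by rw [h n]

lemma arrivalIndex_natCast (h : ∃ N, 0 < N ∧ ∀ n, σ (n + N) = σ n) (hm : 0 < jobsPerPeriod σ i)
    (z : ℕ) : arrivalIndex σ i z = Nat.nth (fun n => σ n = i) z := by
  have := nth_add_count_mul (P := fun n => σ n = i) (visits_periodic h)
    (jobsPerPeriod_eq_count (σ := σ) (i := i) ▸ hm) (z % jobsPerPeriod σ i)
    (z / jobsPerPeriod σ i)
  rw [← jobsPerPeriod_eq_count, Nat.mod_add_div] at this
  rw [this, arrivalIndex]
  push_cast
  rw [← Int.natCast_mod, Int.toNat_natCast]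

lemma arrivalIndex_add_mul (hm : 0 < jobsPerPeriod σ i) (z c : ℤ) :
    arrivalIndex σ i (z + jobsPerPeriod σ i * c) = arrivalIndex σ i z + period σ * c := by
  have hm' : (jobsPerPeriod σ i : ℤ) ≠ 0 := by exact_mod_cast hm.ne'
  rw [arrivalIndex, arrivalIndex, Int.add_mul_emod_self_left, Int.add_mul_ediv_left _ _ hm']
  ring

/-- Differences of arrival indices are differences of indices of visits in the future. -/
lemma exists_arrivalIndex_sub_eq (h : ∃ N, 0 < N ∧ ∀ n, σ (n + N) = σ n)
    (hm : 0 < jobsPerPeriod σ i) (z : ℤ) (n : ℕ) : ∃ w : ℕ,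
      arrivalIndex σ i z - arrivalIndex σ i (z - n) =
        (Nat.nth (fun n => σ n = i) (w + n) : ℤ) - Nat.nth (fun n => σ n = i) w := by
  have hm1 : (1 : ℤ) ≤ jobsPerPeriod σ i := by exact_mod_cast hm
  obtain ⟨w, hw⟩ := Int.eq_ofNat_of_zero_le (a := z - n + jobsPerPeriod σ i * |z - n|) (by
    nlinarith [neg_abs_le (z - n), abs_nonneg (z - n)])
  refine ⟨w, ?_⟩
  have e1 := arrivalIndex_add_mul hm (z - n) |z - n|
  have e2 := arrivalIndex_add_mul hm z |z - n|
  have hz : z + jobsPerPeriod σ i * |z - n| = ((w + n : ℕ) : ℤ) := by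
    push_cast
    linarith
  rw [hw, arrivalIndex_natCast h hm] at e1
  rw [hz, arrivalIndex_natCast h hm] at e2
  linarith

lemma arrivalIndex_mono (h : ∃ N, 0 < N ∧ ∀ n, σ (n + N) = σ n)
    (hm : 0 < jobsPerPeriod σ i) : Monotone (arrivalIndex σ i) := by
  intro x y hxy
  obtain ⟨n, hn⟩ := Int.eq_ofNat_of_zero_le (sub_nonneg.2 hxy)
  obtain ⟨w, hw⟩ := exists_arrivalIndex_sub_eq h hm y n
  have hinf := infinite_of_count_pos (P := fun n => σ n = i) (visits_periodic h)
    (jobsPerPeriod_eq_count (σ := σ) (i := i) ▸ hm)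
  have := Nat.nth_monotone hinf (Nat.le_add_right w n)
  have hx : y - n = x := by linarith
  rw [hx] at hw
  have : (Nat.nth (fun n => σ n = i) w : ℤ) ≤ Nat.nth (fun n => σ n = i) (w + n) := by
    exact_mod_cast this
  linarith

lemma sum_arrivalIndex_sub (hm : 0 < jobsPerPeriod σ i) (d : ℕ) :
    ∑ z ∈ Finset.range (jobsPerPeriod σ i),
      (arrivalIndex σ i z - arrivalIndex σ i (z - d)) = d * period σ := by
  induction d with
  | zero => simp
  | succ d ih =>
    have tel := Finset.sum_range_sub (fun z : ℕ => arrivalIndex σ i ((z : ℤ) - (d + 1 : ℕ)))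
      (jobsPerPeriod σ i)
    have e := arrivalIndex_add_mul hm (0 - ((d + 1 : ℕ) : ℤ)) 1
    rw [mul_one, mul_one, add_comm, ← add_sub_assoc, add_zero] at e
    have : ∀ z : ℕ, arrivalIndex σ i z - arrivalIndex σ i (z - (d + 1 : ℕ)) =
        (arrivalIndex σ i z - arrivalIndex σ i (z - d)) +
          (arrivalIndex σ i (((z + 1 : ℕ) : ℤ) - (d + 1 : ℕ)) -
            arrivalIndex σ i (z - (d + 1 : ℕ))) := by
      intro z
      have : ((z + 1 : ℕ) : ℤ) - (d + 1 : ℕ) = z - d := by push_cast; ring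
      rw [this]
      ring
    simp_rw [this]
    rw [Finset.sum_add_distrib, ih, tel]
    simp only [Nat.cast_zero]
    rw [e]
    push_cast
    ring

/-- The time between the arrival of job `0` at a queue and that of an earlier job. -/
lemma sum_interarrival (h : ∃ N, 0 < N ∧ ∀ n, σ (n + N) = σ n) (hm : 0 < jobsPerPeriod σ i)
    (u : ℝ) (T : ℤ → ℝ) (n : ℕ) :
    ∑ n' ∈ Finset.range n, interarrival σ i u T (-(n' : ℤ)) =
      ∑ l ∈ Finset.Ico (arrivalIndex σ i (⌊u * (jobsPerPeriod σ i : ℝ)⌋ - n))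
        (arrivalIndex σ i ⌊u * (jobsPerPeriod σ i : ℝ)⌋), T l := by
  set z := ⌊u * (jobsPerPeriod σ i : ℝ)⌋
  induction n with
  | zero => simp
  | succ n ih =>
    rw [Finset.sum_range_succ, ih, add_comm, interarrival]
    have e1 : z + -(n : ℤ) - 1 = z - (n + 1 : ℕ) := by push_cast; ring
    have e2 : z + -(n : ℤ) = z - n := by ring
    rw [e1, e2, ← Finset.sum_union (Finset.Ico_disjoint_Ico_consecutive _ _ _),
      Finset.Ico_union_Ico_eq_Ico]
    · exact arrivalIndex_mono h hm (by push_cast; linarith)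
    · exact arrivalIndex_mono h hm (by linarith)

/-- Policies in `periodicPolicies` are periodic, and their proportions are as prescribed. -/
lemma of_mem_periodicPolicies {p : Fin R → ℕ} (h : σ ∈ periodicPolicies p k) :
    (∃ N, 0 < N ∧ ∀ n, σ (n + N) = σ n) ∧ (∀ i, 0 < jobsPerPeriod σ i) ∧
      ∀ r, ∑ κ, (jobsPerPeriod σ (r, κ) : ℚ) / period σ = (p r : ℚ) / l1 p := by
  simp only [periodicPolicies, Set.mem_iUnion, proportions, policiesWithPeriod,
    Set.mem_ofPred_eq] at h
  obtain ⟨q, ⟨hq, hsum⟩, N, hN, hper, hcard⟩ := h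
  have hex : ∃ N, 0 < N ∧ ∀ n, σ (n + N) = σ n := ⟨N, hN, hper⟩
  have hpos := (period_mem hex).1
  have key : ∀ i, q i = (jobsPerPeriod σ i : ℚ) / period σ := by
    intro i
    have := jobsPerPeriod_mul (i := i) hN hper
    rw [hcard i, ← Nat.count_eq_card_filter_range, div_eq_div_iff (by positivity) (by positivity)]
    exact_mod_cast this.symm
  refine ⟨hex, fun i => ?_, fun r => ?_⟩
  · by_contra h0
    have : q i = 0 := by rw [key, Nat.eq_zero_of_not_pos h0]; simp
    exact (hq i).ne' this
  · rw [← hsum r]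
    exact Finset.sum_congr rfl fun κ _ => (key _).symm

end Policy

/-! ### Reduction to a single queue -/

/-- Jensen's inequality for powers. -/
lemma lintegral_pow_le_lintegral_pow {α : Type*} [MeasurableSpace α] {m : Measure α}
    [IsProbabilityMeasure m] {f : α → ℝ≥0∞} (hf : Measurable f) {j : ℕ} (hj : 1 ≤ j) :
    (∫⁻ x, f x ∂m) ^ j ≤ ∫⁻ x, f x ^ j ∂m := by
  have hj' : (1 : ℝ≥0∞) ≤ j := by exact_mod_cast hj
  have hj0 : (j : ℝ) ≠ 0 := by positivity
  have h := eLpNorm_le_eLpNorm_of_exponent_le (μ := m) hj' hf.aestronglyMeasurable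
  rw [eLpNorm_one_eq_lintegral_enorm, eLpNorm_eq_lintegral_rpow_enorm_toReal (by positivity)
    (ENNReal.natCast_ne_top j)] at h
  simp only [enorm_eq_self, ENNReal.toReal_natCast, ENNReal.rpow_natCast] at h
  calc (∫⁻ x, f x ∂m) ^ j ≤ ((∫⁻ x, f x ^ j ∂m) ^ (1 / (j : ℝ))) ^ j := by gcongr
    _ = _ := by rw [← ENNReal.rpow_natCast, ← ENNReal.rpow_mul, one_div_mul_cancel hj0,
          ENNReal.rpow_one]

/-- The uniform law on `[0, 1]`. -/
noncomputable abbrev unitLaw : Measure ℝ := (volume : Measure ℝ).restrict (Set.Icc 0 1)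

instance : IsProbabilityMeasure unitLaw := ⟨by simp⟩

lemma lintegral_floor_le {m : ℕ} (hm : 0 < m) (φ : ℤ → ℝ≥0∞) :
    ∫⁻ u, φ ⌊u * (m : ℝ)⌋ ∂unitLaw ≤
      (∑ z ∈ Finset.range m, φ z) * ENNReal.ofReal (1 / m) := by
  have hm0 : (0 : ℝ) < m := by exact_mod_cast hm
  rw [unitLaw, ← Measure.restrict_congr_set Ico_ae_eq_Icc, Finset.sum_mul]
  calc ∫⁻ u in Set.Ico 0 1, φ ⌊u * (m : ℝ)⌋
      ≤ ∫⁻ u in Set.Ico (0 : ℝ) 1, ∑ z ∈ Finset.range m,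
          Set.indicator (Set.Ico ((z : ℝ) / m) ((z + 1) / m)) (fun _ => φ z) u := by
        refine setLIntegral_mono' measurableSet_Ico fun u hu => ?_
        have h0 : 0 ≤ u * m := mul_nonneg hu.1 hm0.le
        obtain ⟨z, hz⟩ := Int.eq_ofNat_of_zero_le (Int.floor_nonneg.2 h0)
        have hfl := Int.floor_eq_iff.1 hz
        have hzm : z < m := by
          have : (z : ℝ) < m := by
            have := hfl.1
            push_cast at this
            nlinarith [hu.2]
          exact_mod_cast this
        refine le_trans (le_of_eq ?_) (Finset.single_le_sum (fun _ _ => zero_le)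
          (Finset.mem_range.2 hzm))
        rw [Set.indicator_of_mem, hz]
        constructor
        · rw [div_le_iff₀ hm0]
          exact_mod_cast hfl.1
        · rw [lt_div_iff₀ hm0]
          exact_mod_cast hfl.2
    _ ≤ ∫⁻ u, ∑ z ∈ Finset.range m,
          Set.indicator (Set.Ico ((z : ℝ) / m) ((z + 1) / m)) (fun _ => φ z) u :=
        setLIntegral_le_lintegral _ _
    _ = _ := by
        rw [lintegral_finsetSum _ fun z _ => measurable_const.indicator measurableSet_Ico]
        refine Finset.sum_congr rfl fun z _ => ?_
        rw [lintegral_indicator_const measurableSet_Ico, Real.volume_Ico]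
        congr 2
        ring

section Queue

variable {R k : ℕ} {σ : Policy R k} {i : Queue R k}

lemma measurable_sum_Ico (b c : ℤ → ℤ) :
    Measurable fun z : ℤ × (ℤ → ℝ) => ∑ l ∈ Finset.Ico (b z.1) (c z.1), z.2 l :=
  measurable_from_prod_countable_right fun z => Finset.measurable_sum
    (Finset.Ico (b z) (c z)) fun l _ => measurable_pi_apply l

lemma measurable_floor_mul (m : ℝ) :
    Measurable fun z : ℝ × (ℤ → ℝ) => ((⌊z.1 * m⌋ : ℤ), z.2) :=
  (Int.measurable_floor.comp (measurable_fst.mul_const m)).prodMk measurable_snd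

lemma measurable_interarrival (n : ℤ) :
    Measurable fun z : ℝ × (ℤ → ℝ) => interarrival σ i z.1 z.2 n := by
  have h := (measurable_sum_Ico (fun z => arrivalIndex σ i (z + n - 1))
    (fun z => arrivalIndex σ i (z + n))).comp (measurable_floor_mul (jobsPerPeriod σ i))
  have e : (fun z : ℝ × (ℤ → ℝ) => interarrival σ i z.1 z.2 n) =
      (fun z : ℤ × (ℤ → ℝ) => ∑ l ∈ Finset.Ico (arrivalIndex σ i (z.1 + n - 1))
        (arrivalIndex σ i (z.1 + n)), z.2 l) ∘
        fun z => ((⌊z.1 * (jobsPerPeriod σ i : ℝ)⌋ : ℤ), z.2) := by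
    funext z
    simp only [interarrival, Function.comp]
  rw [e]
  exact h

/-- The waiting time at a queue, as a function of the service times, the phase, and the
inter-arrival times at the dispatcher. -/
noncomputable def queueWaitOf (σ : Policy R k) (i : Queue R k)
    (z : (ℤ → ℝ) × (ℝ × (ℤ → ℝ))) : ℝ≥0∞ :=
  stationaryWait z.1 (interarrival σ i z.2.1 z.2.2)

lemma measurable_queueWaitOf : Measurable (queueWaitOf σ i) := by
  refine Measurable.iSup fun n => ENNReal.measurable_ofReal.comp
    (Finset.measurable_sum _ fun n' _ => Measurable.sub ?_ ?_)
  · exact (measurable_pi_apply _).comp measurable_fst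
  · exact (measurable_interarrival _).comp measurable_snd

/-- The joint law of the service times, the phase, and the inter-arrival times. -/
noncomputable def queueLaw (arr : Arrivals) (a : ℝ) (ν : Measure ℝ) :
    Measure ((ℤ → ℝ) × (ℝ × (ℤ → ℝ))) :=
  (serviceLaw ν).prod (unitLaw.prod (Measure.infinitePi fun _ : ℤ => arr.law a))

variable (arr : Arrivals) {a : ℝ} (ν : Fin R → Measure ℝ) [∀ r, IsProbabilityMeasure (ν r)]

/-- The part of a sample that matters to one queue. -/
def queueSample (i : Queue R k) (z : (Queue R k → ℝ) × (ℤ → ℝ) × (Queue R k → ℤ → ℝ)) :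
    (ℤ → ℝ) × (ℝ × (ℤ → ℝ)) := (z.2.2 i, (z.1 i, z.2.1))

lemma measurePreserving_queueSample (ha : 0 < a) (i : Queue R k) :
    MeasurePreserving (queueSample i)
      ((Measure.infinitePi fun _ : Queue R k => unitLaw).prod
        ((Measure.infinitePi fun _ : ℤ => arr.law a).prod
          (Measure.infinitePi fun i : Queue R k => Measure.infinitePi fun _ : ℤ => ν i.1)))
      (queueLaw arr a (ν i.1)) := by
  have := isProbabilityMeasure_law arr ha
  have h1 := measurePreserving_eval_infinitePi (fun _ : Queue R k => unitLaw) i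
  have h2 := measurePreserving_eval_infinitePi
    (fun i : Queue R k => Measure.infinitePi fun _ : ℤ => ν i.1) i
  have h3 := h1.prod ((MeasurePreserving.id (Measure.infinitePi fun _ : ℤ => arr.law a)).prod h2)
  have h4 := (measurePreserving_prodAssoc unitLaw (Measure.infinitePi fun _ : ℤ => arr.law a)
    (Measure.infinitePi fun _ : ℤ => ν i.1)).symm
  exact Measure.measurePreserving_swap.comp (h4.comp h3)

lemma wait_eq (ω : Sample R k) : wait σ ω = queueWait σ (σ ω.1) ω := by
  rw [wait, Finset.sum_eq_single (σ ω.1)]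
  · simp
  · intro i _ hi
    rw [Set.indicator_of_notMem]
    simpa using hi.symm
  · simp

lemma measurable_wait : Measurable (wait σ) := by
  refine Finset.measurable_sum _ fun i _ => Measurable.indicator ?_ ?_
  · have hm : Measurable fun ω : Sample R k => queueSample i ω.2 :=
      ((measurable_pi_apply i).comp (measurable_snd.comp (measurable_snd.comp
        measurable_snd))).prodMk (((measurable_pi_apply i).comp (measurable_fst.comp
        measurable_snd)).prodMk (measurable_fst.comp (measurable_snd.comp measurable_snd)))
    have e : queueWait σ i = fun ω => queueWaitOf σ i (queueSample i ω.2) := rfl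
    rw [e]
    exact measurable_queueWaitOf.comp hm
  · have hs : MeasurableSet {n : ℕ | σ n = i} := MeasurableSet.of_discrete
    have hf : Measurable fun ω : Sample R k => ω.1 := measurable_fst
    exact hf hs

lemma uniformOn_visits :
    uniformOn (Set.Iio (period σ)) {v | σ v = i} =
      (jobsPerPeriod σ i : ℝ≥0∞) / (period σ : ℝ≥0∞) := by
  have hfin : (Set.Iio (period σ)).Finite := Set.finite_Iio _
  have e1 : Set.Iio (period σ) = ((Finset.range (period σ) : Finset ℕ) : Set ℕ) := by
    ext
    simp
  have e2 : Set.Iio (period σ) ∩ {v | σ v = i} =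
      (((Finset.range (period σ)).filter fun n => σ n = i : Finset ℕ) : Set ℕ) := by
    ext
    simp
  rw [← uniformOn_inter_self hfin, e2, e1, uniformOn_apply_finset,
    Finset.inter_eq_right.2 (Finset.filter_subset _ _), Finset.card_range, jobsPerPeriod]

lemma isProbabilityMeasure_uniformOn_Iio {N : ℕ} (hN : 0 < N) :
    IsProbabilityMeasure (uniformOn (Set.Iio N)) :=
  isProbabilityMeasure_uniformOn (Set.finite_Iio _) ⟨0, hN⟩

lemma isProbabilityMeasure_sampleLaw (ha : 0 < a)
    (hper : ∃ N, 0 < N ∧ ∀ n, σ (n + N) = σ n) :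
    IsProbabilityMeasure (sampleLaw arr a ν σ) := by
  have := isProbabilityMeasure_law arr ha
  have := isProbabilityMeasure_uniformOn_Iio (period_mem hper).1
  have : IsProbabilityMeasure ((volume : Measure ℝ).restrict (Set.Icc 0 1)) :=
    inferInstanceAs (IsProbabilityMeasure unitLaw)
  unfold sampleLaw
  infer_instance

/-- The law of the waiting time is a mixture over the queues. -/
lemma lintegral_wait_pow (ha : 0 < a) (hper : ∃ N, 0 < N ∧ ∀ n, σ (n + N) = σ n) (j : ℕ) :
    ∫⁻ ω, wait σ ω ^ j ∂sampleLaw arr a ν σ =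
      ∑ i, (jobsPerPeriod σ i : ℝ≥0∞) / (period σ : ℝ≥0∞) *
        ∫⁻ z, queueWaitOf σ i z ^ j ∂queueLaw arr a (ν i.1) := by
  have := isProbabilityMeasure_law arr ha
  have := isProbabilityMeasure_uniformOn_Iio (period_mem hper).1
  have hs : ∀ i : Queue R k, Measurable (Set.indicator {v | σ v = i} fun _ => (1 : ℝ≥0∞)) :=
    fun i => measurable_of_countable _
  have hq : ∀ i : Queue R k, Measurable fun z => queueWaitOf σ i (queueSample i z) ^ j :=
    fun i => (measurable_queueWaitOf.comp
      (measurePreserving_queueSample arr ν ha i).measurable).pow_const j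
  have e : ∀ ω : Sample R k, wait σ ω ^ j = ∑ i,
      Set.indicator {v | σ v = i} (fun _ => (1 : ℝ≥0∞)) ω.1 *
        queueWaitOf σ i (queueSample i ω.2) ^ j := by
    intro ω
    rw [wait_eq, Finset.sum_eq_single (σ ω.1)]
    · rw [Set.indicator_of_mem (by exact rfl), one_mul]
      rfl
    · intro i _ hi
      rw [Set.indicator_of_notMem (by simpa using hi.symm), zero_mul]
    · simp
  simp_rw [e]
  have hsq : ∀ i : Queue R k, Measurable fun ω : Sample R k =>
      Set.indicator {v | σ v = i} (fun _ => (1 : ℝ≥0∞)) ω.1 *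
        queueWaitOf σ i (queueSample i ω.2) ^ j :=
    fun i => ((hs i).comp measurable_fst).mul ((hq i).comp measurable_snd)
  rw [lintegral_finsetSum _ fun i _ => hsq i]
  refine Finset.sum_congr rfl fun i _ => ?_
  rw [sampleLaw, lintegral_prod_mul (hs i).aemeasurable (hq i).aemeasurable,
    lintegral_indicator_const MeasurableSet.of_discrete, one_mul, uniformOn_visits]
  congr 1
  exact (measurePreserving_queueSample arr ν ha i).lintegral_comp
    (measurable_queueWaitOf.pow_const j)

/-! ### The lower bound -/

lemma stationaryWait_const (S : ℤ → ℝ) (t : ℝ) :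
    stationaryWait S (fun _ => t) = ⨆ n : ℕ,
      ENNReal.ofReal (∑ n' ∈ Finset.range (n + 1), S (-(n' : ℤ)) - (n + 1 : ℕ) * t) := by
  simp [stationaryWait, Finset.sum_sub_distrib]

lemma lintegral_sum_interarrival_le (ha : 0 < a) (hper : ∃ N, 0 < N ∧ ∀ n, σ (n + N) = σ n)
    (hm : 0 < jobsPerPeriod σ i) (n : ℕ) :
    ∫⁻ z, ENNReal.ofReal (∑ n' ∈ Finset.range n, interarrival σ i z.1 z.2 (-(n' : ℤ)))
      ∂(unitLaw.prod (Measure.infinitePi fun _ : ℤ => arr.law a)) ≤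
      ENNReal.ofReal (n * (period σ / (jobsPerPeriod σ i * a))) := by
  have := isProbabilityMeasure_law arr ha
  have hm0 : (0 : ℝ) < jobsPerPeriod σ i := by exact_mod_cast hm
  set P := Measure.infinitePi fun _ : ℤ => arr.law a
  have hT : ∀ l : ℤ, ∫⁻ T, ENNReal.ofReal (T l) ∂P = ENNReal.ofReal (1 / a) := by
    intro l
    have h := (measurePreserving_eval_infinitePi (fun _ : ℤ => arr.law a) l).lintegral_comp
      ENNReal.measurable_ofReal
    refine h.trans ?_
    rw [← ofReal_integral_eq_lintegral_ofReal ((memLp_law arr ha).integrable (by norm_num))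
      (ae_nonneg_law arr ha), integral_law arr ha]
  have hsum : ∀ (s : Finset ℤ), ∫⁻ T, ENNReal.ofReal (∑ l ∈ s, T l) ∂P ≤
      s.card * ENNReal.ofReal (1 / a) := by
    intro s
    calc ∫⁻ T, ENNReal.ofReal (∑ l ∈ s, T l) ∂P ≤ ∫⁻ T, ∑ l ∈ s, ENNReal.ofReal (T l) ∂P :=
          lintegral_mono fun T => by
            refine Finset.le_sum_of_subadditive _ ENNReal.ofReal_zero.le ?_ s _
            exact fun x y => ENNReal.ofReal_add_le
      _ = s.card * ENNReal.ofReal (1 / a) := by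
          have hl : ∀ l : ℤ, Measurable fun T : ℤ → ℝ => ENNReal.ofReal (T l) :=
            fun l => ENNReal.measurable_ofReal.comp (measurable_pi_apply l)
          rw [lintegral_finsetSum _ fun l _ => hl l]
          simp [hT]
  have hX : Measurable fun z : ℝ × (ℤ → ℝ) =>
      ENNReal.ofReal (∑ n' ∈ Finset.range n, interarrival σ i z.1 z.2 (-(n' : ℤ))) :=
    ENNReal.measurable_ofReal.comp (Finset.measurable_sum _ fun n' _ => measurable_interarrival _)
  rw [lintegral_prod _ hX.aemeasurable]
  simp_rw [sum_interarrival hper hm]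
  let φ : ℤ → ℝ≥0∞ := fun z => ENNReal.ofReal
    (((arrivalIndex σ i z - arrivalIndex σ i (z - n) : ℤ) : ℝ) * (1 / a))
  calc _ ≤ ∫⁻ u, φ ⌊u * (jobsPerPeriod σ i : ℝ)⌋ ∂unitLaw := by
        refine lintegral_mono fun u => (hsum _).trans (le_of_eq ?_)
        set z := ⌊u * (jobsPerPeriod σ i : ℝ)⌋
        have hmono : 0 ≤ arrivalIndex σ i z - arrivalIndex σ i (z - n) :=
          sub_nonneg.2 (arrivalIndex_mono hper hm (by linarith))
        simp only [φ]
        rw [Int.card_Ico, ENNReal.ofReal_mul (by exact_mod_cast hmono)]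
        congr 1
        rw [← ENNReal.ofReal_natCast]
        congr 1
        exact_mod_cast Int.toNat_of_nonneg hmono
    _ ≤ (∑ z ∈ Finset.range (jobsPerPeriod σ i), φ z) *
          ENNReal.ofReal (1 / jobsPerPeriod σ i) := lintegral_floor_le hm φ
    _ = _ := by
        simp only [φ]
        have hnn : ∀ z : ℕ, 0 ≤ ((arrivalIndex σ i z - arrivalIndex σ i (z - n) : ℤ) : ℝ) *
            (1 / a) := fun z => by
          have : 0 ≤ arrivalIndex σ i z - arrivalIndex σ i (z - n) :=
            sub_nonneg.2 (arrivalIndex_mono hper hm (by linarith))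
          have : (0 : ℝ) ≤ ((arrivalIndex σ i z - arrivalIndex σ i (z - n) : ℤ) : ℝ) := by
            exact_mod_cast this
          positivity
        rw [← ENNReal.ofReal_sum_of_nonneg fun z _ => hnn z, ← ENNReal.ofReal_mul
          (Finset.sum_nonneg fun z _ => hnn z), ← Finset.sum_mul]
        congr 1
        have : ∑ z ∈ Finset.range (jobsPerPeriod σ i),
            ((arrivalIndex σ i z - arrivalIndex σ i (z - n) : ℤ) : ℝ) = n * period σ := by
          exact_mod_cast sum_arrivalIndex_sub (σ := σ) hm n
        rw [this]
        field_simp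

/-- By Jensen's inequality, the waiting time at a queue is bounded below by that of the D/GI/1
queue with the same arrival rate. -/
lemma stationaryWait_const_le_lintegral (ha : 0 < a)
    (hper : ∃ N, 0 < N ∧ ∀ n, σ (n + N) = σ n) (hm : 0 < jobsPerPeriod σ i) (S : ℤ → ℝ) :
    stationaryWait S (fun _ => period σ / (jobsPerPeriod σ i * a)) ≤
      ∫⁻ z, queueWaitOf σ i (S, z)
        ∂(unitLaw.prod (Measure.infinitePi fun _ : ℤ => arr.law a)) := by
  have := isProbabilityMeasure_law arr ha
  rw [stationaryWait_const]
  refine iSup_le fun n => ?_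
  set Q := unitLaw.prod (Measure.infinitePi fun _ : ℤ => arr.law a)
  set C := ∑ n' ∈ Finset.range (n + 1), S (-(n' : ℤ))
  set X : ℝ × (ℤ → ℝ) → ℝ := fun z =>
    ∑ n' ∈ Finset.range (n + 1), interarrival σ i z.1 z.2 (-(n' : ℤ))
  have hX : Measurable X := Finset.measurable_sum _ fun n' _ => measurable_interarrival _
  have h1 : ENNReal.ofReal C ≤ ∫⁻ z, ENNReal.ofReal (C - X z) ∂Q +
      ENNReal.ofReal ((n + 1 : ℕ) * (period σ / (jobsPerPeriod σ i * a))) :=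
    calc ENNReal.ofReal C = ∫⁻ _, ENNReal.ofReal C ∂Q := by simp
      _ ≤ ∫⁻ z, (ENNReal.ofReal (C - X z) + ENNReal.ofReal (X z)) ∂Q := by
          refine lintegral_mono fun z => ?_
          calc ENNReal.ofReal C = ENNReal.ofReal (C - X z + X z) := by simp
            _ ≤ _ := ENNReal.ofReal_add_le
      _ = ∫⁻ z, ENNReal.ofReal (C - X z) ∂Q + ∫⁻ z, ENNReal.ofReal (X z) ∂Q :=
          lintegral_add_right _ (ENNReal.measurable_ofReal.comp hX)
      _ ≤ _ := by
          gcongr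
          exact lintegral_sum_interarrival_le arr ha hper hm (n + 1)
  rw [ENNReal.ofReal_sub _ (by positivity)]
  refine (tsub_le_iff_right.2 h1).trans (lintegral_mono fun z => ?_)
  refine le_iSup_of_le n (le_of_eq ?_)
  simp only [C, X, ← Finset.sum_sub_distrib]

lemma lintegral_stationaryWait_const_le (ν : Measure ℝ) [IsProbabilityMeasure ν] (ha : 0 < a)
    (hper : ∃ N, 0 < N ∧ ∀ n, σ (n + N) = σ n) (hm : 0 < jobsPerPeriod σ i) {j : ℕ}
    (hj : 1 ≤ j) :
    ∫⁻ S, stationaryWait S (fun _ => period σ / (jobsPerPeriod σ i * a)) ^ j ∂serviceLaw ν ≤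
      ∫⁻ z, queueWaitOf σ i z ^ j ∂queueLaw arr a ν := by
  have := isProbabilityMeasure_law arr ha
  rw [queueLaw, lintegral_prod _ (measurable_queueWaitOf.pow_const j).aemeasurable]
  refine lintegral_mono fun S => ?_
  calc _ ≤ (∫⁻ z, queueWaitOf σ i (S, z)
        ∂(unitLaw.prod (Measure.infinitePi fun _ : ℤ => arr.law a))) ^ j := by
          gcongr
          exact stationaryWait_const_le_lintegral arr ha hper hm S
    _ ≤ _ := lintegral_pow_le_lintegral_pow
          (measurable_queueWaitOf.comp measurable_prodMk_left) hj

end Queue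

/-! ### Round-robin policies -/

section RoundRobin

lemma succ_mod_eq_ite {k : ℕ} (hk : 0 < k) (j : ℕ) :
    (j + 1) % k = if j % k + 1 < k then j % k + 1 else 0 := by
  have h := Nat.mod_lt j hk
  rw [← Nat.mod_add_mod]
  split_ifs with h1
  · exact Nat.mod_eq_of_lt h1
  · rw [show j % k + 1 = k by omega, Nat.mod_self]

lemma count_mod_eq {k κ : ℕ} (hκ : κ < k) (b c : ℕ) :
    Nat.count (fun j => j % k = κ) (b + k * c) = Nat.count (fun j => j % k = κ) b + c := by
  have h1 : Nat.count (fun j => j % k = κ) k = 1 := by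
    rw [Nat.count_eq_card_filter_range, Finset.card_eq_one]
    refine ⟨κ, ?_⟩
    ext j
    simp only [Finset.mem_filter, Finset.mem_range, Finset.mem_singleton]
    constructor
    · rintro ⟨hj, h⟩
      rwa [Nat.mod_eq_of_lt hj] at h
    · rintro rfl
      exact ⟨hκ, Nat.mod_eq_of_lt hκ⟩
  rw [count_add_mul_period (fun n => by rw [Nat.add_mod_right]), h1, one_mul]

/-- The number of jobs sent to a queue, when the queues of each type are visited cyclically. -/
lemma count_visits {R k : ℕ} {π : Policy R k}
    (hv : ∀ i n, π n = i ↔ (π n).1 = i.1 ∧ Nat.count (fun n => (π n).1 = i.1) n % k = i.2)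
    (i : Queue R k) (n : ℕ) :
    Nat.count (fun n => π n = i) n =
      Nat.count (fun j => j % k = i.2) (Nat.count (fun n => (π n).1 = i.1) n) := by
  induction n with
  | zero => simp
  | succ n ih =>
    rw [Nat.count_succ, Nat.count_succ, ih]
    by_cases h1 : (π n).1 = i.1
    · rw [if_pos h1, Nat.count_succ]
      congr 1
      exact if_congr ((hv i n).trans (and_iff_right h1)) rfl rfl
    · rw [if_neg h1, if_neg fun hi => h1 (by rw [hi]), add_zero, add_zero]

/-- The number of jobs sent to a queue in `k` periods of the sequence of types. -/
lemma count_visits_mul {R k : ℕ} {π : Policy R k}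
    (hv : ∀ i n, π n = i ↔ (π n).1 = i.1 ∧ Nat.count (fun n => (π n).1 = i.1) n % k = i.2)
    {L : ℕ} (i : Queue R k) (hL : ∀ n, (π (n + L)).1 = i.1 ↔ (π n).1 = i.1) :
    Nat.count (fun n => π n = i) (L * k) = Nat.count (fun n => (π n).1 = i.1) L := by
  have e1 := count_add_mul_period (P := fun m => (π m).1 = i.1) hL 0 k
  have e2 := count_mod_eq i.2.isLt 0 (Nat.count (fun n => (π n).1 = i.1) L)
  rw [zero_add, Nat.count_zero, zero_add] at e1 e2
  rw [count_visits hv, e1, mul_comm _ k, e2]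

variable {R k : ℕ} {p : Fin R → ℕ} {π : Policy R k}

lemma l1_pos (hp : ∀ r, 0 < p r) (r : Fin R) : 0 < l1 p :=
  (hp r).trans_le (Finset.single_le_sum (fun _ _ => Nat.zero_le _) (Finset.mem_univ r))

variable (hp : ∀ r, 0 < p r) (h : π ∈ roundRobinPolicies p k)

include h

omit h in
lemma pos_of_policy (π : Policy R k) : 0 < k := (Nat.zero_le _).trans_lt (π 0).2.isLt

lemma types_periodic (r : Fin R) (n : ℕ) : (π (n + l1 p)).1 = r ↔ (π n).1 = r := by
  rw [h.2.1.1 n]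

lemma count_types (r : Fin R) : Nat.count (fun n => (π n).1 = r) (l1 p) = p r := by
  rw [Nat.count_eq_card_filter_range, h.2.1.2 r]

lemma queue_jobOfType (r : Fin R) (j : ℕ) : ((π (jobOfType π r j)).2 : ℕ) = j % k := by
  induction j with
  | zero => rw [(h.2.2 r).1, Nat.zero_mod]
  | succ j ih => rw [(h.2.2 r).2 j, ih, succ_mod_eq_ite (pos_of_policy π)]

lemma visit_iff (i : Queue R k) (n : ℕ) :
    π n = i ↔ (π n).1 = i.1 ∧ Nat.count (fun n => (π n).1 = i.1) n % k = i.2 := by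
  have key : (π n).1 = i.1 →
      ((π n).2 : ℕ) = Nat.count (fun n => (π n).1 = i.1) n % k := by
    intro h1
    rw [← queue_jobOfType h i.1, jobOfType, Nat.nth_count (p := fun n => (π n).1 = i.1) h1]
  constructor
  · intro hi
    have h1 : (π n).1 = i.1 := by rw [hi]
    exact ⟨h1, by rw [← key h1, hi]⟩
  · rintro ⟨h1, h2⟩
    exact Prod.ext h1 (Fin.ext (by rw [key h1, h2]))

lemma roundRobin_periodic (n : ℕ) : π (n + l1 p * k) = π n := by
  rw [visit_iff h]
  have h1 : ∀ c, (π (n + l1 p * c)).1 = (π n).1 := by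
    intro c
    induction c with
    | zero => rfl
    | succ c ih => rw [Nat.mul_succ, ← add_assoc, h.2.1.1, ih]
  refine ⟨h1 k, ?_⟩
  rw [count_add_mul_period (P := fun m => (π m).1 = (π n).1) (types_periodic h _),
    count_types h, Nat.add_mul_mod_self_right]
  exact (((visit_iff h (π n) n).1 rfl).2)

include hp in
/-- A round-robin policy sends the same number of jobs to all queues of a type. -/
lemma jobsPerPeriod_roundRobin (i : Queue R k) :
    jobsPerPeriod π i * (l1 p * k) = p i.1 * period π := by
  have hM : 0 < l1 p * k := Nat.mul_pos (l1_pos hp i.1) (pos_of_policy π)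
  rw [jobsPerPeriod_mul hM (roundRobin_periodic h),
    count_visits_mul (visit_iff h) i (types_periodic h i.1), count_types h]

include hp in
/-- Consecutive visits of a round-robin policy to a queue are evenly spaced, up to a bounded
error. -/
lemma nth_visit_gap {i : Queue R k} (hm : 0 < jobsPerPeriod π i) (w n : ℕ) :
    n * k * l1 p ≤ p i.1 *
      (Nat.nth (fun m => π m = i) (w + n) - Nat.nth (fun m => π m = i) w + l1 p) := by
  have hper := (of_mem_periodicPolicies h.1).1
  have hinf := infinite_of_count_pos (P := fun n => π n = i) (visits_periodic hper)
    (jobsPerPeriod_eq_count (σ := π) (i := i) ▸ hm)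
  set x := Nat.nth (fun m => π m = i) w with hx
  set y := Nat.nth (fun m => π m = i) (w + n) with hy
  have hxy : x ≤ y := Nat.nth_monotone hinf (Nat.le_add_right w n)
  have hvx := ((visit_iff h i x).1 (Nat.nth_mem_of_infinite hinf w)).2
  have hvy := ((visit_iff h i y).1 (Nat.nth_mem_of_infinite hinf (w + n))).2
  have cx : Nat.count (fun n => π n = i) x = w := Nat.count_nth_of_infinite hinf w
  have cy : Nat.count (fun n => π n = i) y = w + n := Nat.count_nth_of_infinite hinf (w + n)
  rw [count_visits (visit_iff h)] at cx cy
  set C := Nat.count fun n => (π n).1 = i.1 with hC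
  rw [← Nat.mod_add_div (C x) k, hvx, count_mod_eq i.2.isLt] at cx
  rw [← Nat.mod_add_div (C y) k, hvy, count_mod_eq i.2.isLt] at cy
  have hdiv : C y / k = C x / k + n := by omega
  have hCy : C y = C x + k * n := by
    rw [← Nat.mod_add_div (C y) k, hvy, hdiv, ← Nat.mod_add_div (C x) k, hvx]
    have hk := pos_of_policy π
    rw [Nat.add_mul_div_left _ _ hk, Nat.div_eq_of_lt i.2.isLt]
    ring
  have hL := l1_pos hp i.1
  have hle : y ≤ x + l1 p * ((y - x) / l1 p + 1) := by
    have := Nat.lt_mul_div_succ (y - x) hL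
    omega
  have hcount := Nat.count_monotone (fun n => (π n).1 = i.1) hle
  rw [count_add_mul_period (P := fun m => (π m).1 = i.1) (types_periodic h _),
    count_types h] at hcount
  have hkn : k * n ≤ p i.1 * ((y - x) / l1 p + 1) := by
    change C y ≤ C x + _ at hcount
    omega
  have hdm := Nat.div_mul_le_self (y - x) (l1 p)
  calc n * k * l1 p = k * n * l1 p := by ring
    _ ≤ p i.1 * ((y - x) / l1 p + 1) * l1 p := Nat.mul_le_mul_right _ hkn
    _ = p i.1 * ((y - x) / l1 p * l1 p + l1 p) := by ring
    _ ≤ _ := by gcongr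

include hp in
lemma arrivalIndex_gap {i : Queue R k} (hm : 0 < jobsPerPeriod π i) (z : ℤ) (n : ℕ) :
    (n * k * l1 p : ℤ) ≤ p i.1 * (arrivalIndex π i z - arrivalIndex π i (z - n) + l1 p) := by
  have hper := (of_mem_periodicPolicies h.1).1
  have hinf := infinite_of_count_pos (P := fun n => π n = i) (visits_periodic hper)
    (jobsPerPeriod_eq_count (σ := π) (i := i) ▸ hm)
  obtain ⟨w, hw⟩ := exists_arrivalIndex_sub_eq hper hm z n
  have hgap := nth_visit_gap hp h hm w n
  have hmono := Nat.nth_monotone hinf (Nat.le_add_right w n)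
  rw [hw, ← Nat.cast_sub hmono]
  exact_mod_cast hgap

end RoundRobin

/-! ### The upper bound for round-robin policies -/

lemma sum_Ico_eq_sum_range (f : ℤ → ℝ) (A : ℤ) (G : ℕ) :
    ∑ l ∈ Finset.Ico (A - G) A, f l = ∑ n ∈ Finset.range G, f (A - 1 - n) := by
  induction G with
  | zero => simp
  | succ G ih =>
    have e : Finset.Ico (A - (G + 1 : ℕ)) (A - G) = {A - 1 - G} := by
      ext l
      simp only [Finset.mem_Ico, Finset.mem_singleton]
      push_cast
      constructor
      · rintro ⟨h1, h2⟩
        linarith [Int.le_sub_one_of_lt h2]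
      · rintro rfl
        constructor <;> linarith
    rw [Finset.sum_range_succ, ← ih, ← Finset.Ico_union_Ico_eq_Ico
      (show A - ((G + 1 : ℕ) : ℤ) ≤ A - G by push_cast; linarith) (show A - (G : ℤ) ≤ A by linarith),
      Finset.sum_union (Finset.Ico_disjoint_Ico_consecutive _ _ _), e, Finset.sum_singleton,
      add_comm]

lemma ofReal_sum_le_pathSup (x : ℕ → ℝ) (n : ℕ) :
    ENNReal.ofReal (∑ i ∈ Finset.range n, x i) ≤ pathSup x := by
  cases n with
  | zero => simp
  | succ n => exact le_iSup (fun n => ENNReal.ofReal (∑ i ∈ Finset.range (n + 1), x i)) n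

lemma pow_add_le (x y : ℝ≥0∞) (j : ℕ) : (x + y) ^ j ≤ 2 ^ j * (x ^ j + y ^ j) := by
  wlog hxy : x ≤ y generalizing x y
  · rw [add_comm x y, add_comm (x ^ j)]
    exact this y x (le_of_not_ge hxy)
  calc (x + y) ^ j ≤ (2 * y) ^ j := by
        gcongr
        rw [two_mul]
        gcongr
    _ = 2 ^ j * y ^ j := mul_pow _ _ _
    _ ≤ _ := by
        gcongr
        exact le_add_self

lemma convex_pow_le {θ : ℝ} (h0 : 0 ≤ θ) (h1 : θ ≤ 1) (x y : ℝ≥0∞) {j : ℕ} (hj : 1 ≤ j) :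
    (ENNReal.ofReal (1 - θ) * x + ENNReal.ofReal θ * y) ^ j ≤
      ENNReal.ofReal (1 - θ) * x ^ j + ENNReal.ofReal θ * y ^ j := by
  have h := ENNReal.rpow_arith_mean_le_arith_mean2_rpow (ENNReal.ofReal (1 - θ))
    (ENNReal.ofReal θ) x y (by
      rw [← ENNReal.ofReal_add (by linarith) h0]
      simp) (p := j) (by exact_mod_cast hj)
  simpa only [ENNReal.rpow_natCast] using h

section Queue

variable {R k : ℕ} {p : Fin R → ℕ} {π : Policy R k}

/-- How much the arrivals before job `A` at the dispatcher lag behind a stream of rate `a / ρ`. -/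
noncomputable def lag (ρ a : ℝ) (A : ℤ) (T : ℤ → ℝ) : ℝ≥0∞ :=
  pathSup fun n => ρ / a - T (A - 1 - n)

lemma measurable_lag (ρ a : ℝ) (A : ℤ) : Measurable (lag ρ a A) :=
  measurable_pathSup.comp (measurable_pi_lambda _ fun _ =>
    measurable_const.sub (measurable_pi_apply _))

lemma measurable_stationaryWait_const (t : ℝ) :
    Measurable fun S : ℤ → ℝ => stationaryWait S fun _ => t :=
  measurable_pathSup.comp (measurable_pi_lambda _ fun _ =>
    (measurable_pi_apply _).sub measurable_const)

/-- The index of job `0` of queue `i` at the dispatcher. -/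
noncomputable def originIndex (π : Policy R k) (i : Queue R k) (u : ℝ) : ℤ :=
  arrivalIndex π i ⌊u * (jobsPerPeriod π i : ℝ)⌋

lemma measurable_lag_originIndex (ρ a : ℝ) (i : Queue R k) :
    Measurable fun z : ℝ × (ℤ → ℝ) => lag ρ a (originIndex π i z.1) z.2 := by
  have h : Measurable fun z : ℤ × (ℤ → ℝ) => lag ρ a (arrivalIndex π i z.1) z.2 :=
    measurable_from_prod_countable_right fun z => measurable_lag ρ a (arrivalIndex π i z)
  have e : (fun z : ℝ × (ℤ → ℝ) => lag ρ a (originIndex π i z.1) z.2) =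
      (fun z : ℤ × (ℤ → ℝ) => lag ρ a (arrivalIndex π i z.1) z.2) ∘
        fun z => ((⌊z.1 * (jobsPerPeriod π i : ℝ)⌋ : ℤ), z.2) := by
    funext z
    simp only [originIndex, Function.comp]
  rw [e]
  exact h.comp (measurable_floor_mul _)

lemma queueWaitOf_le (hp : ∀ r, 0 < p r) (h : π ∈ roundRobinPolicies p k) {lam : ℝ}
    (hlam : 0 < lam) (i : Queue R k) {t₀ θ : ℝ} (ht₀ : 0 ≤ t₀)
    (ht₀' : t₀ ≤ l1 p / (p i.1 * lam)) (hθ0 : 0 ≤ θ) (hθ1 : θ ≤ 1)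
    (z : (ℤ → ℝ) × (ℝ × (ℤ → ℝ))) :
    queueWaitOf π i z ≤
      ENNReal.ofReal (1 - θ) * stationaryWait z.1 (fun _ => l1 p / (p i.1 * lam)) +
        ENNReal.ofReal θ * stationaryWait z.1 (fun _ => t₀) +
        (ENNReal.ofReal (l1 p / (lam * k)) +
          lag (1 - θ + θ * (t₀ / (l1 p / (p i.1 * lam)))) (lam * k)
            (originIndex π i z.2.1) z.2.2) := by
  obtain ⟨S, u, T⟩ := z
  have hper := (of_mem_periodicPolicies h.1).1
  have hm := (of_mem_periodicPolicies h.1).2.1 i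
  have hpr : (0 : ℝ) < p i.1 := by exact_mod_cast hp i.1
  have hL : (0 : ℝ) < l1 p := by exact_mod_cast l1_pos hp i.1
  have hk : (0 : ℝ) < k := by exact_mod_cast pos_of_policy π
  set t : ℝ := l1 p / (p i.1 * lam) with ht
  have htpos : 0 < t := by positivity
  set ρ : ℝ := 1 - θ + θ * (t₀ / t) with hρ
  have hρ0 : 0 ≤ ρ := by
    have := div_nonneg ht₀ htpos.le
    have : 0 ≤ 1 - θ := by linarith
    positivity
  have hρ1 : ρ ≤ 1 := by
    have : t₀ / t ≤ 1 := (div_le_one htpos).2 ht₀'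
    nlinarith
  have ha : 0 < lam * k := by positivity
  have htheta : ρ * t = (1 - θ) * t + θ * t₀ := by
    rw [hρ]
    field_simp
  refine iSup_le fun n => ?_
  have hsum := sum_interarrival hper hm u T (n + 1)
  set z₀ := ⌊u * (jobsPerPeriod π i : ℝ)⌋ with hz₀
  have hgap := arrivalIndex_gap hp h hm z₀ (n + 1)
  have hmono : arrivalIndex π i (z₀ - (n + 1 : ℕ)) ≤ arrivalIndex π i z₀ :=
    arrivalIndex_mono hper hm (by push_cast; linarith)
  obtain ⟨G, hG⟩ := Int.eq_ofNat_of_zero_le (sub_nonneg.2 hmono)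
  have hA : arrivalIndex π i (z₀ - (n + 1 : ℕ)) = originIndex π i u - G := by
    rw [originIndex, ← hz₀, ← hG]
    ring
  rw [hA, show arrivalIndex π i z₀ = originIndex π i u from rfl, sum_Ico_eq_sum_range] at hsum
  rw [hG] at hgap
  have hgap' : ((n + 1 : ℕ) : ℝ) * k * l1 p ≤ p i.1 * (G + l1 p) := by exact_mod_cast hgap
  have htime : ((n + 1 : ℕ) : ℝ) * t ≤ (G + l1 p) / (lam * k) := by
    rw [ht, le_div_iff₀ ha, mul_div_assoc', div_mul_eq_mul_div, div_le_iff₀ (by positivity)]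
    nlinarith
  have hlag : ((n + 1 : ℕ) : ℝ) * (ρ * t) ≤
      l1 p / (lam * k) + ∑ _n' ∈ Finset.range G, ρ / (lam * k) := by
    rw [Finset.sum_const, Finset.card_range, nsmul_eq_mul]
    calc ((n + 1 : ℕ) : ℝ) * (ρ * t) = ρ * ((n + 1 : ℕ) * t) := by ring
      _ ≤ ρ * ((G + l1 p) / (lam * k)) := by gcongr
      _ = ρ * (l1 p / (lam * k)) + G * (ρ / (lam * k)) := by ring
      _ ≤ 1 * (l1 p / (lam * k)) + G * (ρ / (lam * k)) := by gcongr
      _ = _ := by ring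
  have hdecomp : ∑ n' ∈ Finset.range (n + 1), (S (-(n' : ℤ)) - interarrival π i u T (-(n' : ℤ)))
      ≤ (1 - θ) * ∑ n' ∈ Finset.range (n + 1), (S (-(n' : ℤ)) - t) +
        θ * ∑ n' ∈ Finset.range (n + 1), (S (-(n' : ℤ)) - t₀) +
        (l1 p / (lam * k) +
          ∑ n' ∈ Finset.range G, (ρ / (lam * k) - T (originIndex π i u - 1 - n'))) := by
    simp only [Finset.sum_sub_distrib]
    rw [hsum]
    simp only [Finset.sum_const, Finset.card_range, nsmul_eq_mul] at hlag ⊢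
    rw [htheta] at hlag
    linarith
  refine (ENNReal.ofReal_le_ofReal hdecomp).trans ?_
  refine ENNReal.ofReal_add_le.trans (add_le_add (ENNReal.ofReal_add_le.trans (add_le_add ?_ ?_))
    (ENNReal.ofReal_add_le.trans (add_le_add le_rfl (ofReal_sum_le_pathSup _ G))))
  · rw [ENNReal.ofReal_mul (by linarith)]
    gcongr
    exact le_iSup (fun n : ℕ => ENNReal.ofReal
      (∑ n' ∈ Finset.range (n + 1), (S (-(n' : ℤ)) - t))) n
  · rw [ENNReal.ofReal_mul hθ0]
    gcongr
    exact le_iSup (fun n : ℕ => ENNReal.ofReal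
      (∑ n' ∈ Finset.range (n + 1), (S (-(n' : ℤ)) - t₀))) n

/-- For round-robin policies, the moments of the waiting time at a queue are bounded above,
uniformly over the queues of the same type, by a quantity close to the moments of the waiting time
of the limiting D/GI/1 queue. -/
lemma exists_lintegral_queueWaitOf_le (arr : Arrivals) (ν : Measure ℝ) [IsProbabilityMeasure ν]
    (hp : ∀ r, 0 < p r) {lam : ℝ} (hlam : 0 < lam) (r : Fin R) {t₀ θ : ℝ} (ht₀ : 0 ≤ t₀)
    (ht₀' : t₀ < l1 p / (p r * lam)) (hθ0 : 0 < θ) (hθ1 : θ ≤ 1) {j : ℕ}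
    (hj : j = 1 ∨ j = 2) :
    ∃ δ : ℕ → ℝ≥0∞, Tendsto δ atTop (𝓝 0) ∧
      ∀ (k : ℕ) (π : Policy R k), π ∈ roundRobinPolicies p k → ∀ κ : Fin k,
        ∫⁻ z, queueWaitOf π (r, κ) z ^ j ∂queueLaw arr (lam * k) ν ≤
          ENNReal.ofReal (1 - θ) *
            ∫⁻ S, stationaryWait S (fun _ => l1 p / (p r * lam)) ^ j ∂serviceLaw ν +
          ENNReal.ofReal θ * (2 ^ j *
            ∫⁻ S, stationaryWait S (fun _ => t₀) ^ j ∂serviceLaw ν) + δ k := by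
  have hj1 : 1 ≤ j := by omega
  have hj0 : j ≠ 0 := by omega
  set t : ℝ := l1 p / (p r * lam) with ht
  have hpr : (0 : ℝ) < p r := by exact_mod_cast hp r
  have hL : (0 : ℝ) < l1 p := by exact_mod_cast l1_pos hp r
  have htpos : 0 < t := by positivity
  set ρ : ℝ := 1 - θ + θ * (t₀ / t) with hρ
  have hρ0 : 0 ≤ ρ := by
    have := div_nonneg ht₀ htpos.le
    have : 0 ≤ 1 - θ := by linarith
    positivity
  have hρ1 : ρ < 1 := by
    have : t₀ / t < 1 := (div_lt_one htpos).2 ht₀'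
    nlinarith
  obtain ⟨K, hK⟩ := exists_lintegral_lag_le arr hρ0 hρ1 hj
  have hθne : ENNReal.ofReal θ ≠ 0 := by simpa using hθ0
  set c : ℕ → ℝ≥0∞ := fun k => ENNReal.ofReal (l1 p / (lam * k)) with hc
  set E : ℝ≥0∞ := ENNReal.ofReal θ * (2 ^ j * (((ENNReal.ofReal θ)⁻¹) ^ j * 2 ^ j)) with hE
  have hEtop : E ≠ ∞ := by
    refine ENNReal.mul_ne_top ENNReal.ofReal_ne_top (ENNReal.mul_ne_top (by finiteness)
      (ENNReal.mul_ne_top (ENNReal.pow_ne_top (ENNReal.inv_ne_top.2 hθne)) (by finiteness)))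
  refine ⟨fun k => E * (c k ^ j + ENNReal.ofReal (K / (lam * k) ^ j)), ?_, ?_⟩
  · have hk : Tendsto (fun k : ℕ => lam * (k : ℝ)) atTop atTop :=
      tendsto_natCast_atTop_atTop.const_mul_atTop hlam
    have h1 : Tendsto (fun k => c k ^ j) atTop (𝓝 0) := by
      have := (ENNReal.continuous_ofReal.tendsto 0).comp (hk.const_div_atTop (l1 p : ℝ))
      rw [ENNReal.ofReal_zero] at this
      have := ENNReal.Tendsto.pow (n := j) this
      rwa [zero_pow hj0] at this
    have h2 : Tendsto (fun k : ℕ => ENNReal.ofReal (K / (lam * k) ^ j)) atTop (𝓝 0) := by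
      have := (ENNReal.continuous_ofReal.tendsto 0).comp
        (((tendsto_pow_atTop hj0).comp hk).const_div_atTop K)
      rwa [ENNReal.ofReal_zero] at this
    have := ENNReal.Tendsto.const_mul (h1.add h2) (a := E) (Or.inr hEtop)
    simpa using this
  · intro k π h κ
    have ha : 0 < lam * (k : ℝ) := by
      have : (0 : ℝ) < k := by exact_mod_cast pos_of_policy π
      positivity
    have := isProbabilityMeasure_law arr ha
    set A : (ℤ → ℝ) × (ℝ × (ℤ → ℝ)) → ℝ≥0∞ := fun z => stationaryWait z.1 fun _ => t with hA
    set B : (ℤ → ℝ) × (ℝ × (ℤ → ℝ)) → ℝ≥0∞ := fun z => stationaryWait z.1 fun _ => t₀ with hB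
    set D : (ℤ → ℝ) × (ℝ × (ℤ → ℝ)) → ℝ≥0∞ := fun z =>
      lag ρ (lam * k) (originIndex π (r, κ) z.2.1) z.2.2 with hD
    have mA : Measurable A := (measurable_stationaryWait_const t).comp measurable_fst
    have mB : Measurable B := (measurable_stationaryWait_const t₀).comp measurable_fst
    have mD : Measurable D := (measurable_lag_originIndex (π := π) ρ (lam * k) (r, κ)).comp
      measurable_snd
    have pointwise : ∀ z, queueWaitOf π (r, κ) z ^ j ≤ ENNReal.ofReal (1 - θ) * A z ^ j +
        ENNReal.ofReal θ * (2 ^ j * B z ^ j) + E * (c k ^ j + D z ^ j) := by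
      intro z
      have hle := queueWaitOf_le hp h hlam (r, κ) ht₀ ht₀'.le hθ0.le hθ1 z
      have e1 : c k + D z = ENNReal.ofReal θ * ((ENNReal.ofReal θ)⁻¹ * (c k + D z)) := by
        rw [← mul_assoc, ENNReal.mul_inv_cancel hθne ENNReal.ofReal_ne_top, one_mul]
      have hle' : queueWaitOf π (r, κ) z ≤ ENNReal.ofReal (1 - θ) * A z +
          ENNReal.ofReal θ * (B z + (ENNReal.ofReal θ)⁻¹ * (c k + D z)) := by
        rw [mul_add, ← e1, ← add_assoc]
        exact hle
      calc queueWaitOf π (r, κ) z ^ j ≤ _ := pow_le_pow_left' hle' j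
        _ ≤ _ := convex_pow_le hθ0.le hθ1 _ _ hj1
        _ ≤ ENNReal.ofReal (1 - θ) * A z ^ j + ENNReal.ofReal θ * (2 ^ j * (B z ^ j +
            ((ENNReal.ofReal θ)⁻¹) ^ j * (2 ^ j * (c k ^ j + D z ^ j)))) := by
            gcongr
            refine (pow_add_le _ _ j).trans ?_
            rw [mul_pow]
            gcongr
            exact pow_add_le _ _ j
        _ = _ := by
            rw [hE]
            ring
    have iA : ∫⁻ z, A z ^ j ∂queueLaw arr (lam * k) ν =
        ∫⁻ S, stationaryWait S (fun _ => t) ^ j ∂serviceLaw ν := by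
      have hm : Measurable fun S : ℤ → ℝ => stationaryWait S (fun _ => t) ^ j :=
        (measurable_stationaryWait_const t).pow_const j
      have := measurePreserving_fst (μ := serviceLaw ν)
        (ν := unitLaw.prod (Measure.infinitePi fun _ : ℤ => arr.law (lam * k)))
      exact this.lintegral_comp hm
    have iB : ∫⁻ z, B z ^ j ∂queueLaw arr (lam * k) ν =
        ∫⁻ S, stationaryWait S (fun _ => t₀) ^ j ∂serviceLaw ν := by
      have hm : Measurable fun S : ℤ → ℝ => stationaryWait S (fun _ => t₀) ^ j :=
        (measurable_stationaryWait_const t₀).pow_const j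
      have := measurePreserving_fst (μ := serviceLaw ν)
        (ν := unitLaw.prod (Measure.infinitePi fun _ : ℤ => arr.law (lam * k)))
      exact this.lintegral_comp hm
    have iD : ∫⁻ z, D z ^ j ∂queueLaw arr (lam * k) ν ≤
        ENNReal.ofReal (K / (lam * k) ^ j) := by
      refine (lintegral_prod_le _).trans ?_
      refine (lintegral_mono fun S => lintegral_prod_le _).trans ?_
      refine (lintegral_mono fun S => lintegral_mono fun u =>
        hK _ ha (originIndex π (r, κ) u)).trans ?_
      simp [serviceLaw]
    have : IsProbabilityMeasure (queueLaw arr (lam * k) ν) := by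
      unfold queueLaw serviceLaw
      infer_instance
    calc _ ≤ _ := lintegral_mono pointwise
      _ = ENNReal.ofReal (1 - θ) * ∫⁻ z, A z ^ j ∂queueLaw arr (lam * k) ν +
          ENNReal.ofReal θ * (2 ^ j * ∫⁻ z, B z ^ j ∂queueLaw arr (lam * k) ν) +
          E * (c k ^ j + ∫⁻ z, D z ^ j ∂queueLaw arr (lam * k) ν) := by
          have mAB : Measurable fun z => ENNReal.ofReal (1 - θ) * A z ^ j +
              ENNReal.ofReal θ * (2 ^ j * B z ^ j) :=
            ((mA.pow_const j).const_mul _).add (((mB.pow_const j).const_mul _).const_mul _)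
          have mCD : Measurable fun z => c k ^ j + D z ^ j :=
            measurable_const.add (mD.pow_const j)
          rw [lintegral_add_left mAB,
            lintegral_add_left ((mA.pow_const j).const_mul _),
            lintegral_const_mul _ (mA.pow_const j),
            lintegral_const_mul _ ((mB.pow_const j).const_mul _),
            lintegral_const_mul _ (mB.pow_const j),
            lintegral_const_mul _ mCD,
            lintegral_add_left measurable_const]
          simp
      _ ≤ _ := by
          rw [iA, iB]
          exact add_le_add le_rfl (mul_le_mul_right (add_le_add le_rfl iD) E)

end Queue

/-! ### Round-robin policies with the least period -/

lemma exists_types {R : ℕ} (p : Fin R → ℕ) (hL : 0 < l1 p) :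
    ∃ τ : ℕ → Fin R, (∀ n, τ (n + l1 p) = τ n) ∧
      ∀ r, Nat.count (fun n => τ n = r) (l1 p) = p r := by
  let e : (Σ r : Fin R, Fin (p r)) ≃ Fin (l1 p) := finSigmaFinEquiv
  refine ⟨fun n => (e.symm ⟨n % l1 p, Nat.mod_lt n hL⟩).1, fun n => ?_, fun r => ?_⟩
  · simp only [Nat.add_mod_right]
  · rw [Nat.count_eq_card_filter_range, Finset.card_filter,
      ← Fin.sum_univ_eq_sum_range
        (fun n => if (e.symm ⟨n % l1 p, Nat.mod_lt n hL⟩).1 = r then 1 else 0)]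
    have : ∀ x : Fin (l1 p), (if (e.symm ⟨(x : ℕ) % l1 p, Nat.mod_lt _ hL⟩).1 = r then 1 else 0)
        = if (e.symm x).1 = r then 1 else 0 := fun x => by
      congr
      exact Nat.mod_eq_of_lt x.isLt
    simp_rw [this]
    rw [Equiv.sum_comp e.symm fun s : (Σ r : Fin R, Fin (p r)) => if s.1 = r then 1 else 0,
      Fintype.sum_sigma]
    simp [apply_ite Finset.card]

/-- There is a round-robin policy whose period is the least one compatible with its
proportions. -/
lemma exists_roundRobin_minPeriod {R k : ℕ} (hk : 0 < k) {p : Fin R → ℕ} (hp : ∀ r, 0 < p r)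
    (r₀ : Fin R) : ∃ π : Policy R k, π ∈ roundRobinPolicies p k ∧ π ∈ minPeriodPolicies p k := by
  set g := Finset.univ.gcd p with hg
  have hgdvd : ∀ r, g ∣ p r := fun r => Finset.gcd_dvd (Finset.mem_univ r)
  have hg0 : 0 < g := Nat.pos_of_dvd_of_pos (hgdvd r₀) (hp r₀)
  set p' : Fin R → ℕ := fun r => p r / g with hp'
  have hpp : ∀ r, p' r * g = p r := fun r => Nat.div_mul_cancel (hgdvd r)
  have hp'0 : ∀ r, 0 < p' r := fun r => Nat.div_pos (Nat.le_of_dvd (hp r) (hgdvd r)) hg0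
  have hL' : 0 < l1 p' := l1_pos hp'0 r₀
  have hLL : l1 p' * g = l1 p := by
    simp only [l1, Finset.sum_mul, hpp]
  have hL : 0 < l1 p := l1_pos hp r₀
  obtain ⟨τ, hτ, hcount⟩ := exists_types p' hL'
  have hτr : ∀ r n, τ (n + l1 p') = r ↔ τ n = r := fun r n => by rw [hτ n]
  have hinf : ∀ r, (Set.ofPred fun n => τ n = r).Infinite := fun r =>
    infinite_of_count_pos (P := fun n => τ n = r) (hτr r) (by rw [hcount]; exact hp'0 r)
  have hτg : ∀ c n, τ (n + l1 p' * c) = τ n := by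
    intro c n
    induction c with
    | zero => rfl
    | succ c ih => rw [Nat.mul_succ, ← add_assoc, hτ, ih]
  let π : Policy R k := fun n => (τ n, ⟨Nat.count (fun m => τ m = τ n) n % k, Nat.mod_lt _ hk⟩)
  have hv : ∀ i n, π n = i ↔ (π n).1 = i.1 ∧ Nat.count (fun n => (π n).1 = i.1) n % k = i.2 := by
    intro i n
    constructor
    · rintro rfl
      exact ⟨rfl, rfl⟩
    · rintro ⟨h1, h2⟩
      change τ n = i.1 at h1
      refine Prod.ext h1 (Fin.ext ?_)
      rw [← h2]
      simp only [π, h1]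
  have hper : ∀ n, π (n + l1 p' * k) = π n := by
    intro n
    rw [hv]
    refine ⟨hτg k n, ?_⟩
    change Nat.count (fun m => τ m = τ n) (n + l1 p' * k) % k = _
    rw [count_add_mul_period (P := fun m => τ m = τ n) (hτr _), Nat.add_mul_mod_self_right]
  have hvis : ∀ i, Nat.count (fun n => π n = i) (l1 p' * k) = p' i.1 := fun i => by
    rw [count_visits_mul hv i (hτr i.1)]
    exact hcount i.1
  let q : Queue R k → ℚ := fun i => p i.1 / (l1 p * k)
  have hkq : (k : ℚ) ≠ 0 := by exact_mod_cast hk.ne'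
  have hLq : (l1 p : ℚ) ≠ 0 := by exact_mod_cast hL.ne'
  have hgq : (g : ℚ) ≠ 0 := by exact_mod_cast hg0.ne'
  have hL'q : (l1 p' : ℚ) ≠ 0 := by exact_mod_cast hL'.ne'
  have hLLq : (l1 p : ℚ) = l1 p' * g := by exact_mod_cast hLL.symm
  have hppq : ∀ r, (p r : ℚ) = p' r * g := fun r => by exact_mod_cast (hpp r).symm
  have hq : q ∈ proportions p k := by
    refine ⟨fun i => ?_, fun r => ?_⟩
    · have : (0 : ℚ) < p i.1 := by exact_mod_cast hp i.1
      have : (0 : ℚ) < l1 p * k := by exact_mod_cast Nat.mul_pos hL hk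
      positivity
    · simp only [q, Finset.sum_const, Finset.card_univ, Fintype.card_fin, nsmul_eq_mul]
      field_simp
  have hπq : π ∈ policiesWithPeriod (l1 p' * k) q := by
    refine ⟨hper, fun i => ?_⟩
    rw [← Nat.count_eq_card_filter_range, hvis i]
    simp only [q, hppq, hLLq]
    push_cast
    field_simp
  have hstar : nStar q = l1 p' * k := by
    refine IsLeast.csInf_eq ⟨⟨Nat.mul_pos hL' hk, fun i => ⟨p' i.1, ?_⟩⟩, ?_⟩
    · simp only [q, hppq, hLLq]
      push_cast
      field_simp
    · rintro n ⟨hn, hint⟩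
      have hdvd : ∀ r, l1 p * k ∣ n * p r := by
        intro r
        obtain ⟨m, hm⟩ := hint (r, ⟨0, hk⟩)
        refine ⟨m, ?_⟩
        simp only [q] at hm
        field_simp at hm
        have : (n : ℚ) * p r = l1 p * k * m := by linarith
        exact_mod_cast this
      have h1 : l1 p * k ∣ Finset.univ.gcd fun r => n * p r :=
        Finset.dvd_gcd fun r _ => hdvd r
      rw [Finset.gcd_mul_left, normalize_eq, ← hg, ← hLL,
        show l1 p' * g * k = l1 p' * k * g by ring] at h1
      exact Nat.le_of_dvd hn (Nat.dvd_of_mul_dvd_mul_right hg0 h1)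
  refine ⟨π, ⟨?_, ⟨fun n => ?_, fun r => ?_⟩, fun r => ?_⟩, ?_⟩
  · simp only [periodicPolicies, Set.mem_iUnion]
    exact ⟨q, hq, l1 p' * k, Nat.mul_pos hL' hk, hπq⟩
  · rw [← hLL]
    exact hτg g n
  · rw [← Nat.count_eq_card_filter_range, ← hLL, ← hpp r, ← hcount r]
    have := count_add_mul_period (P := fun m => τ m = r) (hτr r) 0 g
    rwa [zero_add, Nat.count_zero, zero_add] at this
  · have hjob : ∀ j, ((π (jobOfType π r j)).2 : ℕ) = j % k := by
      intro j
      have h1 : τ (jobOfType π r j) = r := Nat.nth_mem_of_infinite (hinf r) j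
      change Nat.count (fun m => τ m = τ (jobOfType π r j)) (jobOfType π r j) % k = _
      rw [h1, jobOfType]
      change Nat.count (fun m => τ m = r) (Nat.nth (fun m => τ m = r) j) % k = _
      rw [Nat.count_nth_of_infinite (hinf r)]
    refine ⟨by rw [hjob, Nat.zero_mod], fun j => ?_⟩
    rw [hjob, hjob, succ_mod_eq_ite hk]
  · simp only [minPeriodPolicies, Set.mem_iUnion]
    exact ⟨q, hq, by rw [qPolicies, hstar]; exact hπq⟩

/-! ### The limiting queues -/

section Limit

variable {R k : ℕ} {p : Fin R → ℕ}

lemma measurable_limitQueueWait (lam : ℝ) (p : Fin R → ℕ) (r : Fin R) :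
    Measurable (limitQueueWait lam p r) :=
  measurable_stationaryWait_const _

lemma limitMean_eq (lam : ℝ) (p : Fin R → ℕ) (ν : Fin R → Measure ℝ)
    [∀ r, IsProbabilityMeasure (ν r)] :
    limitMean lam p ν =
      ∑ r, ((p r : ℝ≥0∞) / (l1 p : ℝ≥0∞)) * limitQueueMean lam p ν r := by
  have hinst : ∀ r, IsProbabilityMeasure (serviceLaw (ν r)) := fun r => by
    unfold serviceLaw
    infer_instance
  have hm : ∀ r, Measurable fun S : Fin R → ℤ → ℝ => limitQueueWait lam p r (S r) := fun r =>
    (measurable_limitQueueWait lam p r).comp (measurable_pi_apply r)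
  have hw : Measurable (limitWait lam p) := by
    refine measurable_from_prod_countable_right fun r => ?_
    simp only [limitWait]
    exact hm r
  rw [limitMean, limitLaw, lintegral_prod _ hw.aemeasurable, lintegral_finsetSum_measure]
  refine Finset.sum_congr rfl fun r _ => ?_
  rw [lintegral_smul_measure, lintegral_dirac, smul_eq_mul]
  have e := (measurePreserving_eval_infinitePi (fun r => serviceLaw (ν r)) r).lintegral_comp
    (measurable_limitQueueWait lam p r)
  simp only [limitWait, limitQueueMean]
  rw [← e]

lemma minPeriodPolicies_subset (p : Fin R → ℕ) (k : ℕ) :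
    minPeriodPolicies p k ⊆ periodicPolicies p k := by
  intro σ hσ
  simp only [minPeriodPolicies, periodicPolicies, Set.mem_iUnion] at hσ ⊢
  obtain ⟨q, hq, hσq⟩ := hσ
  refine ⟨q, hq, nStar q, ?_, hσq⟩
  by_contra h0
  have h0' : nStar q = 0 := Nat.eq_zero_of_not_pos h0
  have h1 := hσq.2 (σ 0)
  rw [h0'] at h1
  have h2 := hq.1 (σ 0)
  rw [h1] at h2
  simp at h2

/-- The waiting time of a D/GI/1 queue is convex in the arrival rate. -/
lemma mul_stationaryWait_le_sum {ι : Type*} (s : Finset ι) (w t : ι → ℝ) (hw : ∀ i ∈ s, 0 ≤ w i)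
    {W τ : ℝ} (hW : ∑ i ∈ s, w i = W) (hτ : ∑ i ∈ s, w i * t i = W * τ) (S : ℤ → ℝ) :
    ENNReal.ofReal W * stationaryWait S (fun _ => τ) ≤
      ∑ i ∈ s, ENNReal.ofReal (w i) * stationaryWait S (fun _ => t i) := by
  have hW0 : 0 ≤ W := hW ▸ Finset.sum_nonneg hw
  simp only [stationaryWait_const, ENNReal.mul_iSup]
  refine iSup_le fun n => ?_
  set C := ∑ n' ∈ Finset.range (n + 1), S (-(n' : ℤ))
  calc ENNReal.ofReal W * ENNReal.ofReal (C - (n + 1 : ℕ) * τ)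
      = ENNReal.ofReal (∑ i ∈ s, w i * (C - (n + 1 : ℕ) * t i)) := by
        rw [← ENNReal.ofReal_mul hW0]
        congr 1
        have : ∀ i, w i * (C - (n + 1 : ℕ) * t i) = w i * C - (n + 1 : ℕ) * (w i * t i) :=
          fun i => by ring
        simp_rw [this]
        rw [Finset.sum_sub_distrib, ← Finset.sum_mul, ← Finset.mul_sum, hW, hτ]
        ring
    _ ≤ ∑ i ∈ s, ENNReal.ofReal (w i * (C - (n + 1 : ℕ) * t i)) :=
        Finset.le_sum_of_subadditive _ ENNReal.ofReal_zero.le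
          (fun _ _ => ENNReal.ofReal_add_le) s _
    _ ≤ _ := by
        refine Finset.sum_le_sum fun i hi => ?_
        rw [ENNReal.ofReal_mul (hw i hi)]
        exact le_iSup (fun n : ℕ => ENNReal.ofReal (w i) * ENNReal.ofReal
          (∑ n' ∈ Finset.range (n + 1), S (-(n' : ℤ)) - (n + 1 : ℕ) * t i)) n

lemma natCast_div_eq_ofReal {m N : ℕ} (hN : 0 < N) :
    (m : ℝ≥0∞) / (N : ℝ≥0∞) = ENNReal.ofReal ((m : ℝ) / N) := by
  rw [ENNReal.ofReal_div_of_pos (by exact_mod_cast hN), ENNReal.ofReal_natCast,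
    ENNReal.ofReal_natCast]

/-- No periodic policy has a mean waiting time smaller than that of the limit. -/
lemma limitMean_le_meanWait (arr : Arrivals) {lam : ℝ} (hlam : 0 < lam) (ν : Fin R → Measure ℝ)
    [∀ r, IsProbabilityMeasure (ν r)] (hp : ∀ r, 0 < p r) {σ : Policy R k}
    (hσ : σ ∈ periodicPolicies p k) : limitMean lam p ν ≤ meanWait arr (lam * k) ν σ := by
  obtain ⟨hper, hm, hsum⟩ := of_mem_periodicPolicies hσ
  have hN := (period_mem hper).1
  have hN0 : (0 : ℝ) < period σ := by exact_mod_cast hN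
  have hk : (0 : ℝ) < k := by exact_mod_cast pos_of_policy σ
  have ha : 0 < lam * k := by positivity
  have hW := lintegral_wait_pow arr ν ha hper 1
  simp only [pow_one] at hW
  rw [meanWait, hW, limitMean_eq, Fintype.sum_prod_type]
  refine Finset.sum_le_sum fun r _ => ?_
  have hL := l1_pos hp r
  have hL0 : (0 : ℝ) < l1 p := by exact_mod_cast hL
  have hp0 : (0 : ℝ) < p r := by exact_mod_cast hp r
  have hm0 : ∀ κ, (0 : ℝ) < jobsPerPeriod σ (r, κ) := fun κ => by exact_mod_cast hm (r, κ)
  have hsum' : ∑ κ, (jobsPerPeriod σ (r, κ) : ℝ) / period σ = p r / l1 p := by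
    have := congrArg (fun x : ℚ => (x : ℝ)) (hsum r)
    push_cast at this
    exact this
  calc (p r : ℝ≥0∞) / (l1 p : ℝ≥0∞) * limitQueueMean lam p ν r
      = ∫⁻ S, ENNReal.ofReal (p r / l1 p) * stationaryWait S (fun _ => l1 p / (p r * lam))
          ∂serviceLaw (ν r) := by
        rw [natCast_div_eq_ofReal hL, lintegral_const_mul _ (measurable_stationaryWait_const _)]
        rfl
    _ ≤ ∫⁻ S, ∑ κ, ENNReal.ofReal (jobsPerPeriod σ (r, κ) / period σ) * stationaryWait S
          (fun _ => period σ / (jobsPerPeriod σ (r, κ) * (lam * k))) ∂serviceLaw (ν r) := by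
        refine lintegral_mono fun S => mul_stationaryWait_le_sum _ _ _
          (fun κ _ => by positivity) hsum' ?_ S
        have : ∀ κ, (jobsPerPeriod σ (r, κ) : ℝ) / period σ *
            (period σ / (jobsPerPeriod σ (r, κ) * (lam * k))) = 1 / (lam * k) := fun κ => by
          have := hm0 κ
          field_simp
        simp_rw [this]
        rw [Finset.sum_const, Finset.card_univ, Fintype.card_fin, nsmul_eq_mul]
        field_simp
    _ = ∑ κ, ENNReal.ofReal (jobsPerPeriod σ (r, κ) / period σ) * ∫⁻ S, stationaryWait S
          (fun _ => period σ / (jobsPerPeriod σ (r, κ) * (lam * k))) ∂serviceLaw (ν r) := by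
        rw [lintegral_finsetSum _ fun κ _ => (measurable_stationaryWait_const _).const_mul _]
        exact Finset.sum_congr rfl fun κ _ =>
          lintegral_const_mul _ (measurable_stationaryWait_const _)
    _ ≤ _ := by
        refine Finset.sum_le_sum fun κ _ => ?_
        rw [natCast_div_eq_ofReal hN]
        gcongr
        have := lintegral_stationaryWait_const_le arr (σ := σ) (i := (r, κ)) (ν r) ha hper
          (hm (r, κ)) le_rfl
        simpa only [pow_one] using this

/-! ### Convergence of moments -/

/-- Moments of the waiting time under a round-robin policy are averages over types of averages over
the queues of that type. -/
lemma lintegral_wait_pow_roundRobin (arr : Arrivals) {lam : ℝ} (hlam : 0 < lam)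
    (ν : Fin R → Measure ℝ) [∀ r, IsProbabilityMeasure (ν r)] (hp : ∀ r, 0 < p r)
    {π : Policy R k} (h : π ∈ roundRobinPolicies p k) (j : ℕ) :
    ∫⁻ ω, wait π ω ^ j ∂sampleLaw arr (lam * k) ν π =
      ∑ r, ∑ κ : Fin k, (p r : ℝ≥0∞) / (l1 p : ℝ≥0∞) / k *
        ∫⁻ z, queueWaitOf π (r, κ) z ^ j ∂queueLaw arr (lam * k) (ν r) := by
  obtain ⟨hper, hm, -⟩ := of_mem_periodicPolicies h.1
  have hk : 0 < k := pos_of_policy π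
  have hk0 : (0 : ℝ) < k := by exact_mod_cast hk
  have hN := (period_mem hper).1
  rw [lintegral_wait_pow arr ν (by positivity) hper j, Fintype.sum_prod_type]
  refine Finset.sum_congr rfl fun r _ => Finset.sum_congr rfl fun κ _ => ?_
  congr 1
  have hL := l1_pos hp r
  have hL0 : (0 : ℝ) < l1 p := by exact_mod_cast hL
  have hN0 : (0 : ℝ) < period π := by exact_mod_cast hN
  have e : (jobsPerPeriod π (r, κ) : ℝ) * (l1 p * k) = p r * period π := by
    exact_mod_cast jobsPerPeriod_roundRobin hp h (r, κ)
  rw [natCast_div_eq_ofReal hN, natCast_div_eq_ofReal hL, ← ENNReal.ofReal_natCast k,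
    ← ENNReal.ofReal_div_of_pos hk0]
  congr 1
  field_simp
  linarith

lemma sum_div_mul_const (hk : 0 < k) (w x : ℝ≥0∞) : ∑ _κ : Fin k, w / k * x = w * x := by
  rw [Finset.sum_const, Finset.card_univ, Fintype.card_fin, nsmul_eq_mul, ← mul_assoc,
    ENNReal.mul_div_cancel (by exact_mod_cast hk.ne') (ENNReal.natCast_ne_top k)]

/-- The moments of the limiting waiting times are lower bounds for round-robin policies. -/
lemma le_lintegral_wait_pow (arr : Arrivals) {lam : ℝ} (hlam : 0 < lam)
    (ν : Fin R → Measure ℝ) [∀ r, IsProbabilityMeasure (ν r)] (hp : ∀ r, 0 < p r)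
    {π : Policy R k} (h : π ∈ roundRobinPolicies p k) {j : ℕ} (hj : 1 ≤ j) :
    ∑ r, (p r : ℝ≥0∞) / (l1 p : ℝ≥0∞) *
        ∫⁻ S, limitQueueWait lam p r S ^ j ∂serviceLaw (ν r) ≤
      ∫⁻ ω, wait π ω ^ j ∂sampleLaw arr (lam * k) ν π := by
  obtain ⟨hper, hm, -⟩ := of_mem_periodicPolicies h.1
  have hk : 0 < k := pos_of_policy π
  have hk0 : (0 : ℝ) < k := by exact_mod_cast hk
  rw [lintegral_wait_pow_roundRobin arr hlam ν hp h j]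
  refine Finset.sum_le_sum fun r _ => ?_
  rw [← sum_div_mul_const hk]
  refine Finset.sum_le_sum fun κ _ => ?_
  gcongr
  have hmain := lintegral_stationaryWait_const_le arr (σ := π) (i := (r, κ)) (ν r)
    (a := lam * k) (by positivity) hper (hm (r, κ)) hj
  have hL0 : (0 : ℝ) < l1 p := by exact_mod_cast l1_pos hp r
  have hp0 : (0 : ℝ) < p r := by exact_mod_cast hp r
  have hm0 : (0 : ℝ) < jobsPerPeriod π (r, κ) := by exact_mod_cast hm (r, κ)
  have e : (jobsPerPeriod π (r, κ) : ℝ) * (l1 p * k) = p r * period π := by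
    exact_mod_cast jobsPerPeriod_roundRobin hp h (r, κ)
  have et : (period π : ℝ) / (jobsPerPeriod π (r, κ) * (lam * k)) = l1 p / (p r * lam) := by
    rw [div_eq_div_iff (by positivity) (by positivity)]
    linear_combination (-lam) * e
  rw [et] at hmain
  exact hmain

lemma tendsto_lintegral_wait_pow (arr : Arrivals) {lam : ℝ} (hlam : 0 < lam)
    (ν : Fin R → Measure ℝ) [∀ r, IsProbabilityMeasure (ν r)] (hp : ∀ r, 0 < p r)
    (hmem : ∀ r, MemLp (fun x : ℝ => x) 3 (ν r)) (hnonneg : ∀ r, 0 ≤ ∫ x, x ∂ν r)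
    (hstable : ∀ r, ∫ x, x ∂ν r < l1 p / (p r * lam)) {j : ℕ} (hj : j = 1 ∨ j = 2)
    {π : ∀ k : ℕ+, Policy R k} (hπ : ∀ k : ℕ+, π k ∈ roundRobinPolicies p k) :
    Tendsto (fun k : ℕ+ => ∫⁻ ω, wait (π k) ω ^ j ∂sampleLaw arr (lam * (k : ℕ)) ν (π k)) atTop
      (𝓝 (∑ r, (p r : ℝ≥0∞) / (l1 p : ℝ≥0∞) *
        ∫⁻ S, limitQueueWait lam p r S ^ j ∂serviceLaw (ν r))) := by
  have hj1 : 1 ≤ j := by omega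
  set w : Fin R → ℝ≥0∞ := fun r => (p r : ℝ≥0∞) / (l1 p : ℝ≥0∞) with hw
  have hwtop : ∀ r, w r ≠ ∞ := fun r => ENNReal.div_ne_top (ENNReal.natCast_ne_top _)
    (by exact_mod_cast (l1_pos hp r).ne')
  set α : Fin R → ℝ≥0∞ := fun r => ∫⁻ S, limitQueueWait lam p r S ^ j ∂serviceLaw (ν r) with hα
  set t₀ : Fin R → ℝ := fun r => (∫ x, x ∂ν r + l1 p / (p r * lam)) / 2 with ht₀
  set β : Fin R → ℝ≥0∞ := fun r =>
    2 ^ j * ∫⁻ S, stationaryWait S (fun _ => t₀ r) ^ j ∂serviceLaw (ν r) with hβ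
  have hαtop : ∀ r, α r ≠ ∞ := fun r =>
    lintegral_stationaryWait_const_ne_top (hmem r) (hstable r) hj
  have hβtop : ∀ r, β r ≠ ∞ := fun r => ENNReal.mul_ne_top (by finiteness)
    (lintegral_stationaryWait_const_ne_top (hmem r)
      (by simp only [ht₀]; linarith [hstable r]) hj)
  have hbound : ∀ θ : ℝ, 0 < θ → θ ≤ 1 →
      limsup (fun k : ℕ+ => ∫⁻ ω, wait (π k) ω ^ j ∂sampleLaw arr (lam * (k : ℕ)) ν (π k)) atTop ≤
        ∑ r, w r * (ENNReal.ofReal (1 - θ) * α r + ENNReal.ofReal θ * β r) := by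
    intro θ hθ0 hθ1
    have hδ := fun r => exists_lintegral_queueWaitOf_le arr (ν r) hp hlam r
      (t₀ := t₀ r) (θ := θ) (by simp only [ht₀]; linarith [hstable r, hnonneg r])
      (by simp only [ht₀]; linarith [hstable r]) hθ0 hθ1 hj
    choose δ hδ0 hδ using hδ
    have hle : ∀ k : ℕ+, ∫⁻ ω, wait (π k) ω ^ j ∂sampleLaw arr (lam * (k : ℕ)) ν (π k) ≤
        ∑ r, w r * (ENNReal.ofReal (1 - θ) * α r + ENNReal.ofReal θ * β r + δ r k) := by
      intro k
      rw [lintegral_wait_pow_roundRobin arr hlam ν hp (hπ k) j]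
      refine Finset.sum_le_sum fun r _ => ?_
      rw [← sum_div_mul_const k.pos]
      exact Finset.sum_le_sum fun κ _ => mul_le_mul_right (hδ r k (π k) (hπ k) κ) _
    have hlim : Tendsto (fun k : ℕ+ =>
        ∑ r, w r * (ENNReal.ofReal (1 - θ) * α r + ENNReal.ofReal θ * β r + δ r k)) atTop
        (𝓝 (∑ r, w r * (ENNReal.ofReal (1 - θ) * α r + ENNReal.ofReal θ * β r + 0))) := by
      refine tendsto_finsetSum _ fun r _ => ENNReal.Tendsto.const_mul ?_ (Or.inr (hwtop r))
      exact tendsto_const_nhds.add ((hδ0 r).comp tendsto_PNat_val_atTop_atTop)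
    simp only [add_zero] at hlim
    calc _ ≤ _ := limsup_le_limsup (Eventually.of_forall hle)
      _ = _ := hlim.limsup_eq
  have hθ : Tendsto (fun θ : ℝ =>
      ∑ r, w r * (ENNReal.ofReal (1 - θ) * α r + ENNReal.ofReal θ * β r)) (𝓝[>] 0)
      (𝓝 (∑ r, w r * (ENNReal.ofReal (1 - 0) * α r + ENNReal.ofReal 0 * β r))) := by
    refine Tendsto.mono_left ?_ nhdsWithin_le_nhds
    refine tendsto_finsetSum _ fun r _ => ENNReal.Tendsto.const_mul ?_ (Or.inr (hwtop r))
    refine Tendsto.add (ENNReal.Tendsto.mul_const ?_ (Or.inr (hαtop r)))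
      (ENNReal.Tendsto.mul_const ?_ (Or.inr (hβtop r)))
    · exact (ENNReal.continuous_ofReal.comp (continuous_const.sub continuous_id)).tendsto 0
    · exact ENNReal.continuous_ofReal.tendsto 0
  simp only [sub_zero, ENNReal.ofReal_one, one_mul, ENNReal.ofReal_zero, zero_mul, add_zero] at hθ
  refine tendsto_of_le_liminf_of_limsup_le ?_ ?_
  · exact le_liminf_of_le (by isBoundedDefault)
      (Eventually.of_forall fun k => le_lintegral_wait_pow arr hlam ν hp (hπ k) hj1)
  · refine ge_of_tendsto hθ ?_
    filter_upwards [Ioc_mem_nhdsGT (zero_lt_one (α := ℝ))] with θ hθ'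
    exact hbound θ hθ'.1 hθ'.2

/-- The variance of an extended nonnegative random variable in terms of its moments. -/
lemma variance_toReal {Ω : Type*} [MeasurableSpace Ω] {P : Measure Ω} [IsProbabilityMeasure P]
    {X : Ω → ℝ≥0∞} (hX : Measurable X) (h : ∫⁻ ω, X ω ^ 2 ∂P ≠ ∞) :
    variance (fun ω => (X ω).toReal) P =
      (∫⁻ ω, X ω ^ 2 ∂P).toReal - (∫⁻ ω, X ω ∂P).toReal ^ 2 := by
  have hlt : ∀ᵐ ω ∂P, X ω ^ 2 < ∞ := ae_lt_top (hX.pow_const 2) h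
  have hlt' : ∀ᵐ ω ∂P, X ω < ∞ := by
    filter_upwards [hlt] with ω hω
    by_contra hc
    rw [not_lt, top_le_iff] at hc
    simp [hc] at hω
  have hint : Integrable (fun ω => (X ω).toReal ^ 2) P := by
    have := integrable_toReal_of_lintegral_ne_top (hX.pow_const 2).aemeasurable h
    simpa only [ENNReal.toReal_pow] using this
  have hL2 : MemLp (fun ω => (X ω).toReal) 2 P :=
    (memLp_two_iff_integrable_sq hX.ennreal_toReal.aestronglyMeasurable).2 hint
  rw [variance_eq_sub hL2, ← integral_toReal hX.aemeasurable hlt',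
    ← integral_toReal (hX.pow_const 2).aemeasurable hlt]
  simp [ENNReal.toReal_pow]

end Limit

end ParallelQueues

theorem theorem2 {R : ℕ} (arr : Arrivals) (lam : ℝ) (hlam : 0 < lam)
    (μ : Fin R → ℝ) (ν : Fin R → Measure ℝ) [∀ r, IsProbabilityMeasure (ν r)]
    (hpos : ∀ r, ∀ᵐ x ∂ν r, 0 < x) (hmean : ∀ r, ∫ x, x ∂ν r = (μ r)⁻¹)
    (hthird : ∀ r, Integrable (fun x => x ^ 3) (ν r))
    (p : Fin R → ℕ) (hp : ∀ r, 0 < p r)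
    (hload : ∀ r, lam * ((p r : ℝ) / (l1 p : ℝ)) < μ r)
    (π : ∀ k : ℕ+, Policy R k) (hπ : ∀ k : ℕ+, π k ∈ roundRobinPolicies p k) :
    -- the mean waiting times converge to the finite number `𝔼 W(p)`
    (limitMean lam p ν ≠ ∞ ∧
      limitMean lam p ν = ∑ r, ((p r : ℝ≥0∞) / (l1 p : ℝ≥0∞)) * limitQueueMean lam p ν r ∧
      Tendsto (fun k : ℕ+ => meanWait arr (lam * (k : ℕ)) ν (π k)) atTop
        (𝓝 (limitMean lam p ν))) ∧
    -- asymptotic optimality, among the periodic policies with period `n^*(q)` and among all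
    -- periodic policies
    (liminf (fun k : ℕ+ => ⨅ σ ∈ minPeriodPolicies p k, meanWait arr (lam * (k : ℕ)) ν σ) atTop =
        limitMean lam p ν ∧
      liminf (fun k : ℕ+ => ⨅ σ ∈ periodicPolicies p k, meanWait arr (lam * (k : ℕ)) ν σ) atTop =
        limitMean lam p ν) ∧
    -- convergence of the variances; all of them are those of square-integrable variables
    ((∀ r, Integrable (fun x => x ^ 5) (ν r)) →
      (∀ r, ∫⁻ S, limitQueueWait lam p r S ^ 2 ∂serviceLaw (ν r) ≠ ∞) ∧
      (∀ᶠ k : ℕ+ in atTop,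
        ∫⁻ ω, wait (π k) ω ^ 2 ∂sampleLaw arr (lam * (k : ℕ)) ν (π k) ≠ ∞) ∧
      Tendsto (fun k : ℕ+ =>
          variance (fun ω => (wait (π k) ω).toReal) (sampleLaw arr (lam * (k : ℕ)) ν (π k))) atTop
        (𝓝 (∑ r, ((p r : ℝ) / (l1 p : ℝ)) *
          (variance (fun S => (limitQueueWait lam p r S).toReal) (serviceLaw (ν r)) +
            ((limitQueueMean lam p ν r).toReal - (limitMean lam p ν).toReal) ^ 2)))) := by
  have hL : ∀ r, (0 : ℝ) < l1 p := fun r => by exact_mod_cast l1_pos hp r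
  have hp0 : ∀ r, (0 : ℝ) < p r := fun r => by exact_mod_cast hp r
  have hμ : ∀ r, 0 < μ r := fun r =>
    lt_of_le_of_lt (by have := hL r; have := hp0 r; positivity) (hload r)
  have hmem : ∀ r, MemLp (fun x : ℝ => x) 3 (ν r) := fun r =>
    memLp_three_of_integrable_cube (hthird r)
  have hnonneg : ∀ r, 0 ≤ ∫ x, x ∂ν r := fun r => by
    rw [hmean r]
    exact (inv_pos.2 (hμ r)).le
  have hstable : ∀ r, ∫ x, x ∂ν r < l1 p / (p r * lam) := fun r => by
    have h1 := hL r
    have h2 := hp0 r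
    rw [hmean r, inv_lt_comm₀ (hμ r) (by positivity), inv_div]
    calc (p r : ℝ) * lam / l1 p = lam * (p r / l1 p) := by ring
      _ < μ r := hload r
  have hwtop : ∀ r, (p r : ℝ≥0∞) / (l1 p : ℝ≥0∞) ≠ ∞ := fun r =>
    ENNReal.div_ne_top (ENNReal.natCast_ne_top _) (by exact_mod_cast (l1_pos hp r).ne')
  have hfin : ∀ {j : ℕ}, j = 1 ∨ j = 2 → ∀ r,
      ∫⁻ S, limitQueueWait lam p r S ^ j ∂serviceLaw (ν r) ≠ ∞ := fun hj r =>
    lintegral_stationaryWait_const_ne_top (hmem r) (hstable r) hj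
  have hfin1 : ∀ r, limitQueueMean lam p ν r ≠ ∞ := fun r => by
    simpa only [pow_one, limitQueueMean] using hfin (Or.inl rfl) r
  have hlimit := limitMean_eq lam p ν
  have hlimtop : limitMean lam p ν ≠ ∞ := by
    rw [hlimit]
    exact ENNReal.sum_ne_top.2 fun r _ => ENNReal.mul_ne_top (hwtop r) (hfin1 r)
  have hconv : ∀ {π : ∀ k : ℕ+, Policy R k}, (∀ k : ℕ+, π k ∈ roundRobinPolicies p k) →
      Tendsto (fun k : ℕ+ => meanWait arr (lam * (k : ℕ)) ν (π k)) atTop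
        (𝓝 (limitMean lam p ν)) := fun hπ => by
    have h := tendsto_lintegral_wait_pow arr hlam ν hp hmem hnonneg hstable (Or.inl rfl) hπ
    simp only [pow_one] at h
    rw [hlimit]
    exact h
  have r₀ : Fin R := (π 1 0).1
  refine ⟨⟨hlimtop, hlimit, hconv hπ⟩, ⟨?_, ?_⟩, fun _ => ?_⟩
  · have hex := fun k : ℕ+ => exists_roundRobin_minPeriod k.pos hp r₀
    choose σ hσ hσmin using hex
    refine (tendsto_of_tendsto_of_tendsto_of_le_of_le tendsto_const_nhds (hconv hσ)
      (fun k => ?_) fun k => ?_).liminf_eq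
    · exact le_iInf₂ fun τ hτ =>
        limitMean_le_meanWait arr hlam ν hp (minPeriodPolicies_subset p k hτ)
    · exact iInf₂_le (σ k) (hσmin k)
  · refine (tendsto_of_tendsto_of_tendsto_of_le_of_le tendsto_const_nhds (hconv hπ)
      (fun k => ?_) fun k => ?_).liminf_eq
    · exact le_iInf₂ fun τ hτ => limitMean_le_meanWait arr hlam ν hp hτ
    · exact iInf₂_le (π k) (hπ k).1
  · have h2 := tendsto_lintegral_wait_pow arr hlam ν hp hmem hnonneg hstable (Or.inr rfl) hπ
    set M2 := ∑ r, (p r : ℝ≥0∞) / (l1 p : ℝ≥0∞) *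
      ∫⁻ S, limitQueueWait lam p r S ^ 2 ∂serviceLaw (ν r) with hM2
    have hM2top : M2 ≠ ∞ :=
      ENNReal.sum_ne_top.2 fun r _ => ENNReal.mul_ne_top (hwtop r) (hfin (Or.inr rfl) r)
    have hev : ∀ᶠ k : ℕ+ in atTop,
        ∫⁻ ω, wait (π k) ω ^ 2 ∂sampleLaw arr (lam * (k : ℕ)) ν (π k) ≠ ∞ :=
      (h2.eventually_lt_const hM2top.lt_top).mono fun k hk => hk.ne
    refine ⟨hfin (Or.inr rfl), hev, ?_⟩
    have hvar : ∀ᶠ k : ℕ+ in atTop,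
        (∫⁻ ω, wait (π k) ω ^ 2 ∂sampleLaw arr (lam * (k : ℕ)) ν (π k)).toReal -
            (meanWait arr (lam * (k : ℕ)) ν (π k)).toReal ^ 2 =
          variance (fun ω => (wait (π k) ω).toReal) (sampleLaw arr (lam * (k : ℕ)) ν (π k)) := by
      filter_upwards [hev] with k hk
      have hk0 : (0 : ℝ) < (k : ℕ) := by exact_mod_cast k.pos
      have := isProbabilityMeasure_sampleLaw arr ν (σ := π k) (mul_pos hlam hk0)
        (of_mem_periodicPolicies (hπ k).1).1
      exact (variance_toReal measurable_wait hk).symm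
    refine Tendsto.congr' hvar ?_
    have hlim := ((ENNReal.tendsto_toReal hM2top).comp h2).sub
      (((ENNReal.tendsto_toReal hlimtop).comp (hconv hπ)).pow 2)
    refine hlim.trans (le_of_eq (congrArg 𝓝 ?_))
    have hvarr : ∀ r, variance (fun S => (limitQueueWait lam p r S).toReal) (serviceLaw (ν r)) =
        (∫⁻ S, limitQueueWait lam p r S ^ 2 ∂serviceLaw (ν r)).toReal -
          (limitQueueMean lam p ν r).toReal ^ 2 := fun r => by
      have : IsProbabilityMeasure (serviceLaw (ν r)) := by
        unfold serviceLaw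
        infer_instance
      exact variance_toReal (measurable_limitQueueWait lam p r) (hfin (Or.inr rfl) r)
    have hM2r : M2.toReal = ∑ r, (p r : ℝ) / (l1 p : ℝ) *
        (∫⁻ S, limitQueueWait lam p r S ^ 2 ∂serviceLaw (ν r)).toReal := by
      rw [hM2, ENNReal.toReal_sum fun r _ =>
        ENNReal.mul_ne_top (hwtop r) (hfin (Or.inr rfl) r)]
      simp [ENNReal.toReal_mul, ENNReal.toReal_div]
    have hM1r : (limitMean lam p ν).toReal = ∑ r, (p r : ℝ) / (l1 p : ℝ) *
        (limitQueueMean lam p ν r).toReal := by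
      rw [hlimit, ENNReal.toReal_sum fun r _ => ENNReal.mul_ne_top (hwtop r) (hfin1 r)]
      simp [ENNReal.toReal_mul, ENNReal.toReal_div]
    have hsum : ∑ r, (p r : ℝ) / (l1 p : ℝ) = 1 := by
      rw [← Finset.sum_div, div_eq_one_iff_eq (hL r₀).ne', l1]
      push_cast
      rfl
    set m := (limitMean lam p ν).toReal with hm
    simp_rw [hvarr]
    have e : ∀ r, (p r : ℝ) / (l1 p : ℝ) *
        ((∫⁻ S, limitQueueWait lam p r S ^ 2 ∂serviceLaw (ν r)).toReal -
          (limitQueueMean lam p ν r).toReal ^ 2 + ((limitQueueMean lam p ν r).toReal - m) ^ 2) =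
        (p r : ℝ) / (l1 p : ℝ) *
          (∫⁻ S, limitQueueWait lam p r S ^ 2 ∂serviceLaw (ν r)).toReal -
        2 * m * ((p r : ℝ) / (l1 p : ℝ) * (limitQueueMean lam p ν r).toReal) +
        (p r : ℝ) / (l1 p : ℝ) * m ^ 2 := fun r => by ring
    simp_rw [e]
    rw [Finset.sum_add_distrib, Finset.sum_sub_distrib, ← Finset.mul_sum, ← Finset.sum_mul,
      ← hM2r, ← hM1r, hsum]
    ring
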